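/- Work with symmetric functions in infinitely many variables over $\mathbb{C}$: $p_n,h_n,e_n$ are the power sums, complete homogeneous and elementary symmetric functions, $s_\lambda$ the Schur functions, $\omega$ the involution with $\omega(h_n)=e_n$, $f[g]$ denotes plethysm, $F|_{\deg n}$ the degree-$n$ part of $F$, and ${\rm ch}$ the Frobenius characteristic. For $n\ge 1$ let $C_n\le S_n$ be generated by an $n$-cycle, and let ${Lie}_n$, resp. ${Lie}^{(2)}_n$, be the Frobenius characteristic of the $S_n$-module induced from the one-dimensional representation of $C_n$ in which the generator acts by $\exp(2\pi i/n)$, resp. by $\exp(2\pi i\,2^{k_n}/n)$, where $2^{k_n}$ is the largest power of $2$ dividing $n$. Put ${Lie}_{\ge2}=\sum_{n\ge2}{Lie}_n$ and ${Lie}^{(2)}_{\ge2}=\sum_{n\ge2}{Lie}^{(2)}_n$. Let $$\Delta_n^k=e_k[{Lie}^{(2)}_{\ge2}]\big|_{\deg n},\qquad D_n^k=h_k[{Lie}_{\ge2}]\big|_{\deg n},$$ $\Delta_n=\sum_{k\ge1}\Delta_n^k$ for $n\ge2$, and $\Delta_1=0$, $\Delta_0=1$. **Theorem.** 1. For all $n\ge2$,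 $$\Delta_n=\sum_{k=0}^n(-1)^k p_1^{n-k}h_k=p_1\Delta_{n-1}+(-1)^nh_n ,$$ and $\Delta_n$ is the Frobenius characteristic of the $S_n$-module afforded by the top reduced homology $\tilde H_{n-1}(\,\cdot\,;\mathbb{C})$ of the complex of injective words in the alphabet $\{1,\dots,n\}$ (the complex whose $r$-dimensional cells are the words of $r+1$ distinct letters, with faces obtained by deleting letters, and with $S_n$ permuting the letters). 2. For all $n\ge1$, $$\sum_{r\ge1}\omega(D_n^r)=\sum_{k=0}^n(-1)^kp_1^{n-k}h_k=\sum_{r\ge1}\Delta_n^r .$$ 3. For all $n\ge2$, $$\sum_{r\ge1}(-1)^{r-1}\,\omega\big(e_r[{Lie}_{\ge2}]|_{\deg n}\big)=s_{(2,1^{n-2})}=\sum_{r\ge1}(-1)^{r-1}\,h_r[{Lie}^{(2)}_{\ge2}]\big|_{\deg n}.$$ 4. The decomposition $\Delta_n=\sum_k\Delta_n^k$ differs from the Hodge decomposition $\Delta_n=\sum_k\omega(D_n^k)$ of Hanlon and Hersh: for $n=4$, neither of $\Delta_4^1,\Delta_4^2$ is equal to either of $\omega(D_4^1),\omega(D_4^2)$.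 -/

import Mathlib

noncomputable section

namespace SymFn

/-- Formal power series over `ℂ` in the variables `x_0, x_1, x_2, …`. Symmetric functions, and
infinite sums of symmetric functions of increasing degree, are elements of this ring. -/
abbrev Series : Type := MvPowerSeries ℕ ℂ

/-- The power sum `p_k = ∑ i, x_i ^ k` (for `k ≥ 1`). -/
def p (k : ℕ) : Series :=
  fun m => by classical exact if ∃ i, m = Finsupp.single i k then 1 else 0

/-- The complete homogeneous symmetric function `h_n`: the sum of all monomials of degree `n`. -/
def h (n : ℕ) : Series :=
  fun m => if m.degree = n then 1 else 0

/-- The elementary symmetric function `e_n`: the sum of all squarefree monomials of degree `n`. -/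
def e (n : ℕ) : Series :=
  fun m => by classical exact if m.degree = n ∧ ∀ i, m i ≤ 1 then 1 else 0

/-- The Schur function `s_μ`: the coefficient of a monomial `m` is the number of semistandard
Young tableaux of shape `μ` with content `m`. -/
def schur (μ : YoungDiagram) : Series :=
  fun m => (Nat.card {T : SemistandardYoungTableau μ //
    ∀ i, (μ.cells.filter fun c => T c.1 c.2 = i).card = m i} : ℂ)

/-! ### Power sums are algebraically independent -/

section AlgebraicIndependence

theorem esymm_mem_adjoin_psum (N k : ℕ) :
    MvPolynomial.esymm (Fin N) ℂ k ∈
      Algebra.adjoin ℂ (Set.range fun j : Fin N => MvPolynomial.psum (Fin N) ℂ (j + 1)) := by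
  induction k using Nat.strong_induction_on with
  | _ k ih =>
    rcases Nat.eq_zero_or_pos k with rfl | hk
    · simp [MvPolynomial.esymm_zero, one_mem]
    by_cases hkN : N < k
    · have : MvPolynomial.esymm (Fin N) ℂ k = 0 := by
        rw [MvPolynomial.esymm, Finset.powersetCard_eq_empty.2 (by simpa using hkN)]
        simp
      rw [this]
      exact zero_mem _
    · have key := MvPolynomial.mul_esymm_eq_sum (Fin N) ℂ k
      have hk0 : (k : ℂ) ≠ 0 := by exact_mod_cast hk.ne'
      have hsolve : MvPolynomial.esymm (Fin N) ℂ k =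
          (k : ℂ)⁻¹ • ((k : MvPolynomial (Fin N) ℂ) * MvPolynomial.esymm (Fin N) ℂ k) := by
        rw [← nsmul_eq_mul, ← Nat.cast_smul_eq_nsmul ℂ, smul_smul, inv_mul_cancel₀ hk0, one_smul]
      rw [hsolve, key]
      refine Subalgebra.smul_mem _ (mul_mem (pow_mem (neg_mem (one_mem _)) _) ?_) _
      refine sum_mem fun a ha => ?_
      rw [Finset.mem_filter, Finset.HasAntidiagonal.mem_antidiagonal] at ha
      refine mul_mem (mul_mem (pow_mem (neg_mem (one_mem _)) _) (ih _ ha.2)) ?_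
      refine Algebra.subset_adjoin ⟨⟨a.2 - 1, by omega⟩, ?_⟩
      have : a.2 - 1 + 1 = a.2 := by omega
      simp [this]

theorem algebraicIndependent_psum (N : ℕ) :
    AlgebraicIndependent ℂ (fun j : Fin N => MvPolynomial.psum (Fin N) ℂ (j + 1)) := by
  have halg : Algebra.IsAlgebraic
      (Algebra.adjoin ℂ (Set.range fun j : Fin N => MvPolynomial.psum (Fin N) ℂ (j + 1)))
      (MvPolynomial (Fin N) ℂ) := by
    set S := Algebra.adjoin ℂ (Set.range fun j : Fin N => MvPolynomial.psum (Fin N) ℂ (j + 1))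
      with hS
    have hX : ∀ i : Fin N, IsIntegral S (MvPolynomial.X i : MvPolynomial (Fin N) ℂ) := by
      intro i
      have hV := MvPolynomial.prod_C_add_X_eq_sum_esymm ℂ (Fin N)
      have hlift : (∏ j : Fin N, (Polynomial.X + Polynomial.C
          (MvPolynomial.X j : MvPolynomial (Fin N) ℂ))) ∈
          Polynomial.lifts (algebraMap S (MvPolynomial (Fin N) ℂ)) := by
        rw [hV]
        refine sum_mem fun j _ => mul_mem ?_ ?_
        · exact Polynomial.C_mem_lifts _ (⟨_, esymm_mem_adjoin_psum N j⟩ : S)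
        · exact pow_mem (Polynomial.X_mem_lifts _) _
      have hmonic : (∏ j : Fin N, (Polynomial.X + Polynomial.C
          (MvPolynomial.X j : MvPolynomial (Fin N) ℂ))).Monic :=
        Polynomial.monic_prod_of_monic _ _ fun j _ => Polynomial.monic_X_add_C _
      obtain ⟨q, hq, -, hqm⟩ := Polynomial.lifts_and_degree_eq_and_monic hlift hmonic
      have hneg : IsIntegral S (-(MvPolynomial.X i : MvPolynomial (Fin N) ℂ)) := by
        refine ⟨q, hqm, ?_⟩
        rw [← Polynomial.eval_map, hq, Polynomial.eval_prod]
        exact Finset.prod_eq_zero (Finset.mem_univ i) (by simp)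
      simpa using hneg.neg
    have : Algebra.IsIntegral S (MvPolynomial (Fin N) ℂ) := by
      refine ⟨fun f => ?_⟩
      induction f using MvPolynomial.induction_on with
      | C a => exact isIntegral_algebraMap (R := S) (x := algebraMap ℂ S a)
      | add f g hf hg => exact hf.add hg
      | mul_X f i hf => exact hf.mul (hX i)
    exact this.isAlgebraic
  refine (Algebra.IsAlgebraic.isTranscendenceBasis_of_lift_le_trdeg_of_finite ℂ
    (fun j : Fin N => MvPolynomial.psum (Fin N) ℂ (j + 1)) ?_).1
  simp

theorem killCompl_p (N k : ℕ) :
    MvPowerSeries.killCompl (R := ℂ) (Fin.valEmbedding (n := N)) (p (k + 1)) =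
      (MvPolynomial.psum (Fin N) ℂ (k + 1) : MvPowerSeries (Fin N) ℂ) := by
  classical
  ext m
  rw [MvPolynomial.coeff_coe, MvPolynomial.psum, MvPolynomial.coeff_sum]
  have h1 : MvPowerSeries.coeff m
      (MvPowerSeries.killCompl (R := ℂ) (Fin.valEmbedding (n := N)) (p (k + 1))) =
      if ∃ i, m.embDomain Fin.valEmbedding = Finsupp.single i (k + 1) then 1 else 0 := rfl
  rw [h1]
  simp only [MvPolynomial.coeff_X_pow]
  by_cases hm : ∃ j : Fin N, m = Finsupp.single j (k + 1)
  · obtain ⟨j, rfl⟩ := hm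
    rw [if_pos ⟨j, by simp⟩, Finset.sum_eq_single j]
    · simp
    · intro b _ hb
      rw [if_neg]
      intro hEq
      exact hb ((Finsupp.single_left_inj (by simp)).1 hEq)
    · simp
  · rw [if_neg, Finset.sum_eq_zero]
    · intro j _
      rw [if_neg]
      exact fun hEq => hm ⟨j, hEq.symm⟩
    · rintro ⟨i, hi⟩
      have hi' : i ∈ (m.embDomain Fin.valEmbedding).support := by
        rw [hi]; simp
      rw [Finsupp.support_embDomain, Finset.mem_map] at hi'
      obtain ⟨j, -, rfl⟩ := hi'
      refine hm ⟨j, ?_⟩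
      refine Finsupp.embDomain_injective Fin.valEmbedding ?_
      rw [hi, Finsupp.embDomain_single]

/-- The power sums `p_1, p_2, …` are algebraically independent. -/
theorem algebraicIndependent_p : AlgebraicIndependent ℂ (fun k : ℕ => p (k + 1)) := by
  rw [algebraicIndependent_iff]
  intro P hP
  obtain ⟨N, Q, rfl⟩ : ∃ (N : ℕ) (Q : MvPolynomial (Fin N) ℂ),
      P = MvPolynomial.rename (fun j : Fin N => (j : ℕ)) Q := by
    obtain ⟨N, hN⟩ := P.vars.exists_nat_subset_range
    obtain ⟨Q, hQ⟩ := MvPolynomial.exists_rename_eq_of_vars_subset_range P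
      (fun j : Fin N => (j : ℕ)) Fin.val_injective
      (fun i hi => ⟨⟨i, by simpa using hN hi⟩, rfl⟩)
    exact ⟨N, Q, hQ.symm⟩
  have h0 := congrArg (MvPowerSeries.killCompl (R := ℂ) (Fin.valEmbedding (n := N))) hP
  rw [MvPolynomial.aeval_rename, map_zero, MvPolynomial.comp_aeval_apply] at h0
  have hcoe : MvPolynomial.aeval (fun j : Fin N =>
      MvPowerSeries.killCompl (R := ℂ) (Fin.valEmbedding (n := N)) (p ((j : ℕ) + 1))) Q =
      MvPolynomial.coeToMvPowerSeries.algHom ℂ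
        (MvPolynomial.aeval (fun j : Fin N => MvPolynomial.psum (Fin N) ℂ (j + 1)) Q) := by
    rw [MvPolynomial.comp_aeval_apply]
    congr 2
    funext j
    rw [killCompl_p]
    simp [MvPolynomial.coeToMvPowerSeries.algHom_apply]
  have h1 : MvPolynomial.coeToMvPowerSeries.algHom ℂ
      (MvPolynomial.aeval (fun j : Fin N => MvPolynomial.psum (Fin N) ℂ (j + 1)) Q) =
      (0 : MvPowerSeries (Fin N) ℂ) := by
    rw [← hcoe]; exact h0
  have h2 : MvPolynomial.aeval (fun j : Fin N => MvPolynomial.psum (Fin N) ℂ (j + 1)) Q = 0 := by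
    apply MvPolynomial.coe_injective (Fin N) ℂ
    simpa [MvPolynomial.coeToMvPowerSeries.algHom_apply] using h1
  rw [(algebraicIndependent_iff.1 (algebraicIndependent_psum N)) Q h2, map_zero]

end AlgebraicIndependence

/-! ### Plethysm and the involution `ω` -/

/-- The expression of a symmetric function as a polynomial in the power sums; the variable of
index `k` stands for `p_{k+1}`. It is unique, since the power sums are algebraically independent
(see `toPowerSums_aeval`). -/
def toPowerSums (f : Series) : MvPolynomial ℕ ℂ :=
  Function.invFun (MvPolynomial.aeval fun k : ℕ => p (k + 1)) f

theorem toPowerSums_aeval (P : MvPolynomial ℕ ℂ) :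
    toPowerSums (MvPolynomial.aeval (fun k : ℕ => p (k + 1)) P) = P :=
  Function.leftInverse_invFun algebraicIndependent_p P

/-- The plethysm `f[g]` of a symmetric function `f` with `g`: the image of `f` under the
`ℂ`-algebra homomorphism with `p_k ↦ p_k[g] = g(x_0 ^ k, x_1 ^ k, …)`. -/
def plethysm (f g : Series) : Series :=
  MvPolynomial.aeval (fun k : ℕ => MvPowerSeries.expand (k + 1) k.succ_ne_zero g) (toPowerSums f)

/-- The involution `ω` on symmetric functions: the `ℂ`-algebra homomorphism with
`p_k ↦ (-1) ^ (k - 1) p_k`, which exchanges `h_n` and `e_n`. -/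
def omega (f : Series) : Series :=
  MvPolynomial.aeval (fun k : ℕ => (-1 : Series) ^ k * p (k + 1)) (toPowerSums f)

/-- The part of degree `n` of a series. -/
def deg (n : ℕ) (f : Series) : Series :=
  MvPowerSeries.homogeneousComponent n f

/-- The formal infinite sum `∑_{n ≥ 2} q_n`, where each `q_n` is homogeneous of degree `n`. -/
def sumGeTwo (q : ℕ → Series) : Series :=
  fun m => if 2 ≤ m.degree then MvPowerSeries.coeff m (q m.degree) else 0

/-! ### Frobenius characteristic and the modules `Lie_n` and `Lie_n^{(2)}` -/

/-- The Frobenius characteristic of a representation of the symmetric group of a finite set `α`: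
`(1 / |α|!) ∑_σ tr(ρ(σ)) p_{λ(σ)}`, where `λ(σ)` is the cycle type of `σ` (with fixed points). -/
def frobeniusChar {α V : Type} [Fintype α] [DecidableEq α] [AddCommGroup V] [Module ℂ V]
    (ρ : Representation ℂ (Equiv.Perm α) V) : Series :=
  ((Fintype.card α).factorial : ℂ)⁻¹ •
    ∑ σ : Equiv.Perm α, LinearMap.trace ℂ V (ρ σ) • (σ.partition.parts.map p).prod

/-- The one-dimensional representation of the cyclic group `C_n` on `ℂ` in which the generator
acts as multiplication by `exp (2 π i r / n)`. -/
def cyclicRep (n : ℕ) [NeZero n] (r : ℕ) : Representation ℂ (Multiplicative (ZMod n)) ℂ :=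
  (algebraMap ℂ (Module.End ℂ ℂ) : ℂ →* Module.End ℂ ℂ).comp
    ((ZMod.stdAddChar : AddChar (ZMod n) ℂ).toMonoidHom ^ r)

/-- `C_n` as the subgroup of the symmetric group of the `n`-element set `ℤ/n` generated by the
`n`-cycle `x ↦ x + 1`. -/
def cyclicEmbedding (n : ℕ) : Multiplicative (ZMod n) →* Equiv.Perm (ZMod n) :=
  MulAction.toPermHom (Multiplicative (ZMod n)) (ZMod n)

/-- The Frobenius characteristic of the induced representation
`exp ((2 π i / n) r) ↑_{C_n}^{S_n}`, for `n ≥ 1`. -/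
def cyclicIndChar : ℕ → ℕ → Series
  | 0, _ => 0
  | n + 1, r => frobeniusChar (Representation.ind (cyclicEmbedding (n + 1)) (cyclicRep (n + 1) r))

/-- The Frobenius characteristic of `Lie_n = exp (2 π i / n) ↑_{C_n}^{S_n}`. -/
def lie (n : ℕ) : Series := cyclicIndChar n 1

/-- The Frobenius characteristic of `Lie_n^{(2)} = exp ((2 π i / n) 2 ^ k) ↑_{C_n}^{S_n}`, where
`2 ^ k` is the largest power of `2` dividing `n`. -/
def lieTwo (n : ℕ) : Series := cyclicIndChar n (2 ^ padicValNat 2 n)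

/-- `D_n^k`: the degree `n` part of `h_k[Lie_{≥ 2}]`. -/
def hodgePiece (n k : ℕ) : Series := deg n (plethysm (h k) (sumGeTwo lie))

/-- `Δ_n^k`: the degree `n` part of `e_k[Lie^{(2)}_{≥ 2}]`. -/
def deltaPiece (n k : ℕ) : Series := deg n (plethysm (e k) (sumGeTwo lieTwo))

/-- `Δ_0 = 1`, `Δ_1 = 0`, and `Δ_n = ∑_{k ≥ 1} Δ_n^k` for `n ≥ 2`. -/
def delta : ℕ → Series
  | 0 => 1
  | 1 => 0
  | n + 2 => ∑ᶠ (k : ℕ) (_ : 1 ≤ k), deltaPiece (n + 2) k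

/-- The partition `(2, 1^{n-2})` of `n ≥ 2`, as a Young diagram. -/
def hookTwo (n : ℕ) : YoungDiagram :=
  YoungDiagram.ofRowLens (2 :: List.replicate (n - 2) 1) (by
    apply List.Pairwise.sortedGE
    rw [List.pairwise_cons]
    refine ⟨fun a ha => ?_, ?_⟩
    · rw [List.eq_of_mem_replicate ha]; norm_num
    · exact List.pairwise_replicate.2 (Or.inr le_rfl))

/-! ### The complex of injective words -/

section Homology

variable {G A B C : Type} [Group G] [AddCommGroup A] [Module ℂ A] [AddCommGroup B] [Module ℂ B]
  [AddCommGroup C] [Module ℂ C]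

/-- The homology `ker g / (im f ∩ ker g)` at `B` of `A → B → C`; when `g ∘ f = 0` this is
`ker g / im f`. -/
abbrev Homology (f : A →ₗ[ℂ] B) (g : B →ₗ[ℂ] C) : Type :=
  LinearMap.ker g ⧸ (LinearMap.range f).submoduleOf (LinearMap.ker g)

/-- The action of a group on the homology of `A → B → C` induced by its action on `B`, when
`A → B` and `B → C` are equivariant. -/
def homologyRep (ρA : Representation ℂ G A) (ρB : Representation ℂ G B)
    (ρC : Representation ℂ G C) (f : A →ₗ[ℂ] B) (g : B →ₗ[ℂ] C)
    (hf : ∀ s x, f (ρA s x) = ρB s (f x)) (hg : ∀ s x, g (ρB s x) = ρC s (g x)) :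
    Representation ℂ G (Homology f g) :=
  (ρB.subrepresentation (LinearMap.ker g) fun s x hx => by
    rw [LinearMap.mem_ker] at hx
    rw [Submodule.mem_comap, LinearMap.mem_ker, hg, hx, map_zero]).quotient _ fun s x hx => by
      obtain ⟨y, hy⟩ := hx
      exact ⟨ρA s y, by rw [hf, hy]; rfl⟩

end Homology

/-- The chains on injective words of length `r` in the alphabet `α` (the cells of dimension
`r - 1`; the empty word spans the augmentation), with the action of the symmetric group on
letters. -/
def wordRep (α : Type) (r : ℕ) : Representation ℂ (Equiv.Perm α) ((Fin r ↪ α) →₀ ℂ) where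
  toFun σ := Finsupp.lmapDomain ℂ ℂ fun w => w.trans σ.toEmbedding
  map_one' := by ext; simp; rfl
  map_mul' σ τ := by ext; simp; rfl

/-- The boundary map `a_0 a_1 ⋯ a_r ↦ ∑_i (-1)^i a_0 ⋯ â_i ⋯ a_r`. -/
def wordBoundary (α : Type) (r : ℕ) : ((Fin (r + 1) ↪ α) →₀ ℂ) →ₗ[ℂ] ((Fin r ↪ α) →₀ ℂ) :=
  Finsupp.linearCombination ℂ fun w =>
    ∑ i : Fin (r + 1), (-1 : ℂ) ^ (i : ℕ) •
      Finsupp.single ((Fin.succAboveEmb i).trans w) 1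

theorem wordBoundary_comm (α : Type) (r : ℕ) (σ : Equiv.Perm α) (x : (Fin (r + 1) ↪ α) →₀ ℂ) :
    wordBoundary α r (wordRep α (r + 1) σ x) = wordRep α r σ (wordBoundary α r x) := by
  have : wordBoundary α r ∘ₗ wordRep α (r + 1) σ = wordRep α r σ ∘ₗ wordBoundary α r := by
    ext1 w
    ext1
    simp [wordBoundary, wordRep, Finsupp.mapDomain_single, Function.Embedding.trans_assoc]
  exact LinearMap.congr_fun this x

/-- The representation of the symmetric group of `α` on the reduced homology
`H̃_r = ker ∂_r / im ∂_{r+1}`, with coefficients in `ℂ`, of the complex of injective words in the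
alphabet `α`. -/
def injectiveWordsHomology (α : Type) (r : ℕ) :
    Representation ℂ (Equiv.Perm α) (Homology (wordBoundary α (r + 1)) (wordBoundary α r)) :=
  homologyRep (wordRep α (r + 2)) (wordRep α (r + 1)) (wordRep α r) _ _
    (wordBoundary_comm α (r + 1)) (wordBoundary_comm α r)

end SymFn

end

/-!
Write `Q = Lie_{≥ 2}` or `Q = Lie^{(2)}_{≥ 2}`. The sequences `h_k[Q]` and `e_k[Q]` satisfy Newton's
recursion with power sums `±p_i[Q]`, so the Euler derivation `D` (multiplication by the degree) of
`∑_k h_k[Q]` is `∑_k h_k[Q]` times `∑_i D(p_i[Q]) / i`, and similarly for the three other sums of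
the theorem. Since `n Lie_n = ∑_{d ∣ n} c_d(1) p_d^{n/d}` with the Ramanujan sums `c_d`, the
Dirichlet convolution identities `1 * c_d(1) = δ` and `(-1)^{k-1} * c_d(2^k) = δ` collapse the
logarithmic derivative to that of `(1 - p_1)^{-1}`, or its inverse for the signed sums, up to the
contribution of the omitted term `Lie_1 = p_1`, which is `∑_k e_k` or `∑_k h_k` up to signs. This
determines the four sums degree by degree; `s_{(2,1^{n-2})} = p_1 e_{n-1} - e_n` is Pieri's rule.

The complex of injective words is exact below the top degree: on cycles of words of length `r` in
`n` letters, the boundary of the sum of all ways to prepend a new letter is `(n - r) + M`, where `M`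
moves a letter to the front with alternating signs, and `M` has no negative integer eigenvalue.
Additivity of the trace then gives the top homology as the alternating sum of the permutation
modules on injective words, and the module on words of length `k` has characteristic
`p_1^k h_{n-k}`.

In degree four the pieces are told apart by the coefficient of `p_4`, the power sums being
algebraically independent.
-/

noncomputable section

namespace SymFn

open Finset

/-! ### Newton's recursion and the Euler derivation -/

section Degree

open MvPowerSeries

variable {σ R : Type*}

theorem homogeneousComponent_mul [CommSemiring R] (n : ℕ) (f g : MvPowerSeries σ R) :
    homogeneousComponent n (f * g) =
      ∑ ij ∈ antidiagonal n, homogeneousComponent ij.1 f * homogeneousComponent ij.2 g := by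
  classical
  ext m
  simp only [map_sum, coeff_mul, coeff_homogeneousComponent, ite_zero_mul_ite_zero]
  rw [sum_comm]
  trans ∑ ab ∈ antidiagonal m, if m.degree = n then coeff ab.1 f * coeff ab.2 g else 0
  · split_ifs <;> simp only [sum_const_zero]
  refine sum_congr rfl fun ab hab => ?_
  have degrees_eq_iff (ij : ℕ × ℕ) : ab.1.degree = ij.1 ∧ ab.2.degree = ij.2 ↔
      (ab.1.degree, ab.2.degree) = ij := Prod.mk_inj.symm
  simp only [degrees_eq_iff, sum_ite_eq, HasAntidiagonal.mem_antidiagonal]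
  rw [← HasAntidiagonal.mem_antidiagonal.1 hab, map_add]

theorem isHomogeneous_one [Semiring R] : (1 : MvPowerSeries σ R).IsHomogeneous 0 := by
  classical
  intro m hm
  rw [coeff_one, ne_eq, ite_eq_right_iff, not_forall] at hm
  obtain ⟨rfl, -⟩ := hm
  exact map_zero _

theorem homogeneousComponent_of_isHomogeneous [Semiring R] {f : MvPowerSeries σ R} {d : ℕ}
    (hf : f.IsHomogeneous d) (n : ℕ) : homogeneousComponent n f = if n = d then f else 0 := by
  ext m
  rw [coeff_homogeneousComponent]
  by_cases hm : m.degree = d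
  · simp only [hm, eq_comm (a := d), apply_ite (coeff m), map_zero]
  · simp only [hf.coeff_eq_zero hm, ite_self, apply_ite (coeff m), map_zero]

/-- The Euler derivation `∑ i, x_i ∂/∂x_i`, which multiplies the part of degree `n` by `n`. -/
def euler [CommRing R] : Derivation R (MvPowerSeries σ R) (MvPowerSeries σ R) :=
  Derivation.mk'
    { toFun f := fun m => m.degree • coeff m f
      map_add' f g := by
        ext m
        exact smul_add m.degree (coeff m f) (coeff m g)
      map_smul' a f := by
        ext m
        exact smul_comm m.degree a (coeff m f) }
    fun f g => by
      classical
      ext m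
      change m.degree • coeff m (f * g) = coeff m (f • _ + g • _)
      rw [smul_eq_mul, smul_eq_mul, map_add, mul_comm g, coeff_mul, coeff_mul, coeff_mul, smul_sum,
        ← sum_add_distrib]
      refine sum_congr rfl fun ab hab => ?_
      change _ = coeff ab.1 f * (ab.2.degree • coeff ab.2 g) +
        ab.1.degree • coeff ab.1 f * coeff ab.2 g
      rw [← HasAntidiagonal.mem_antidiagonal.1 hab, map_add]
      simp only [nsmul_eq_mul, Nat.cast_add]
      ring

theorem coeff_euler [CommRing R] (m : σ →₀ ℕ) (f : MvPowerSeries σ R) :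
    coeff m (euler f) = m.degree • coeff m f := rfl

theorem euler_of_isHomogeneous [CommRing R] {f : MvPowerSeries σ R} {d : ℕ}
    (hf : f.IsHomogeneous d) : euler f = d • f := by
  ext m
  rw [coeff_euler, map_nsmul]
  by_cases hm : m.degree = d
  · rw [hm]
  · rw [IsHomogeneous.coeff_eq_zero hf hm, smul_zero, smul_zero]

theorem homogeneousComponent_euler [CommRing R] (n : ℕ) (f : MvPowerSeries σ R) :
    homogeneousComponent n (euler f) = n • homogeneousComponent n f := by
  ext m
  rw [coeff_homogeneousComponent, map_nsmul, coeff_homogeneousComponent, coeff_euler]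
  split_ifs with hm
  · rw [hm]
  · rw [smul_zero]

theorem coeff_expand_of_notMem_range [CommRing R] {k : ℕ} (hk : k ≠ 0) (f : MvPowerSeries σ R)
    {m : σ →₀ ℕ} (hm : m ∉ Set.range fun m' : σ →₀ ℕ => k • m') :
    coeff m (expand k hk f) = 0 := by
  by_contra hne
  have dvd (i : σ) : k ∣ m i := not_imp_comm.1 (coeff_expand_of_not_dvd k hk f) hne
  refine hm ⟨m.mapRange (· / k) (Nat.zero_div k), ?_⟩
  ext i
  exact Nat.mul_div_cancel' (dvd i)

theorem euler_expand [CommRing R] {k : ℕ} (hk : k ≠ 0) (f : MvPowerSeries σ R) :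
    euler (expand k hk f) = k • expand k hk (euler f) := by
  ext m
  rw [coeff_euler, map_nsmul]
  by_cases hm : m ∈ Set.range fun m' : σ →₀ ℕ => k • m'
  · obtain ⟨m', rfl⟩ := hm
    rw [coeff_expand_smul, coeff_expand_smul, coeff_euler, map_nsmul, smul_eq_mul, mul_smul]
  · rw [coeff_expand_of_notMem_range hk _ hm, coeff_expand_of_notMem_range hk _ hm, smul_zero,
      smul_zero]

theorem homogeneousComponent_expand [CommRing R] {k : ℕ} (hk : k ≠ 0) (f : MvPowerSeries σ R)
    (n : ℕ) : homogeneousComponent n (expand k hk f) =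
      if k ∣ n then expand k hk (homogeneousComponent (n / k) f) else 0 := by
  ext m
  rw [coeff_homogeneousComponent, apply_ite (coeff m), map_zero]
  by_cases hm : m ∈ Set.range fun m' : σ →₀ ℕ => k • m'
  · obtain ⟨m', rfl⟩ := hm
    rw [coeff_expand_smul, coeff_expand_smul, coeff_homogeneousComponent, map_nsmul, smul_eq_mul]
    by_cases hn : k ∣ n
    · obtain ⟨j, rfl⟩ := hn
      simp only [mul_right_inj' hk, dvd_mul_right, if_true,
        Nat.mul_div_cancel_left _ (Nat.pos_of_ne_zero hk)]
    · rw [if_neg (by rintro rfl; exact hn (dvd_mul_right _ _)), if_neg hn]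
  · rw [coeff_expand_of_notMem_range hk _ hm, coeff_expand_of_notMem_range hk _ hm, ite_self,
      ite_self]

theorem homogeneousComponent_eq_zero_of_lt [Semiring R] {f : MvPowerSeries σ R} {d n : ℕ}
    (hf : d ≤ f.order) (hn : n < d) : homogeneousComponent n f = 0 :=
  homogeneousComponent_of_lt_order_eq_zero (lt_of_lt_of_le (by exact_mod_cast hn) hf)

end Degree

section LogDerivative

open PowerSeries

variable {R : Type*} [CommRing R]

/-- The sequence `g` is determined by Newton's recursion from the sequence `q`: the generating
function `G = ∑ n, g n t ^ n` has constant coefficient `1` and logarithmic derivative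
`∑ i, q i t ^ i`. For the power sums `q i = p_{i+1}` this gives `g = h`. -/
structure IsExp (q g : ℕ → R) : Prop where
  intro ::
  zero : g 0 = 1
  succ (n : ℕ) : (n + 1) • g (n + 1) = ∑ ij ∈ antidiagonal n, q ij.1 * g ij.2

theorem isExp_iff_derivative_mk {q g : ℕ → R} :
    IsExp q g ↔ g 0 = 1 ∧ derivative R (mk g) = mk q * mk g := by
  have succ_iff : derivative R (mk g) = mk q * mk g ↔
      ∀ n, (n + 1) • g (n + 1) = ∑ ij ∈ antidiagonal n, q ij.1 * g ij.2 := by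
    rw [PowerSeries.ext_iff]
    refine forall_congr' fun n => ?_
    rw [coeff_derivative, coeff_mul]
    simp only [coeff_mk, nsmul_eq_mul, Nat.cast_succ, mul_comm (g (n + 1))]
  rw [succ_iff]
  exact ⟨fun hg => ⟨hg.zero, hg.succ⟩, fun hg => ⟨hg.1, hg.2⟩⟩

theorem eq_zero_of_derivative_eq_mul [IsAddTorsionFree R] {Q W : PowerSeries R}
    (hW : derivative R W = Q * W) (h0 : constantCoeff W = 0) : W = 0 := by
  ext n
  induction n using Nat.strong_induction_on with
  | _ n ih =>
    rcases n with _ | n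
    · simpa using h0
    have coeff_W' := congr_arg (coeff n) hW
    rw [coeff_derivative, coeff_mul, sum_eq_zero fun ij hij => ?_] at coeff_W'
    · refine (nsmul_eq_zero_iff_right n.succ_ne_zero).1 ?_
      rw [nsmul_eq_mul, mul_comm, Nat.cast_succ, coeff_W']
    · have lt : ij.2 < n + 1 := by grind [HasAntidiagonal.mem_antidiagonal]
      rw [ih ij.2 lt, map_zero, mul_zero]

namespace IsExp

variable {q q' g g' : ℕ → R}

theorem unique [IsAddTorsionFree R] (hg : IsExp q g) (hg' : IsExp q g') : g = g' := by
  rw [isExp_iff_derivative_mk] at hg hg'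
  have eq_zero : mk g - mk g' = 0 := by
    refine eq_zero_of_derivative_eq_mul (Q := mk q) ?_ ?_
    · rw [map_sub, hg.2, hg'.2, mul_sub]
    · rw [← coeff_zero_eq_constantCoeff_apply, map_sub, coeff_mk, coeff_mk, hg.1, hg'.1, sub_self]
  funext n
  simpa only [coeff_mk] using congr_arg (coeff n) (sub_eq_zero.1 eq_zero)

theorem map {S : Type*} [CommRing S] (φ : R →+* S) (hg : IsExp q g) : IsExp (φ ∘ q) (φ ∘ g) where
  zero := by rw [Function.comp_apply, hg.zero, map_one]
  succ n := by
    simp only [Function.comp_apply, ← map_nsmul, hg.succ, map_sum, map_mul]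

theorem mul (hg : IsExp q g) (hg' : IsExp q' g') :
    IsExp (q + q') fun n => ∑ ij ∈ antidiagonal n, g ij.1 * g' ij.2 := by
  have mk_sum : (mk fun n => ∑ ij ∈ antidiagonal n, g ij.1 * g' ij.2) = mk g * mk g' := by
    ext n
    simp only [coeff_mul, coeff_mk]
  rw [isExp_iff_derivative_mk] at hg hg' ⊢
  refine ⟨by simp only [Nat.antidiagonal_zero, sum_singleton, hg.1, hg'.1, mul_one], ?_⟩
  rw [mk_sum, Derivation.leibniz, hg.2, hg'.2, show mk (q + q') = mk q + mk q' from rfl]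
  simp only [smul_eq_mul]
  ring

theorem signed (hg : IsExp q g) :
    IsExp (fun i => (-1) ^ (i + 1) * q i) fun n => (-1) ^ n * g n where
  zero := by rw [pow_zero, one_mul, hg.zero]
  succ n := by
    rw [← mul_smul_comm, hg.succ, mul_sum]
    refine sum_congr rfl fun ij hij => ?_
    rw [← HasAntidiagonal.mem_antidiagonal.1 hij]
    ring

theorem derivation_apply_succ [IsAddTorsionFree R] {K : Type*} [CommSemiring K] [Algebra K R]
    (D : Derivation K R R) {z : ℕ → R} (hg : IsExp q g) (hz : ∀ i, D (q i) = (i + 1) • z i)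
    (n : ℕ) : D (g (n + 1)) = ∑ ij ∈ antidiagonal n, z ij.1 * g ij.2 := by
  have derivative_D : derivative R (mk fun n => D (g n)) =
      mk (fun i => D (q i)) * mk g + mk q * mk fun n => D (g n) := by
    ext n
    have D_succ := congr_arg D (hg.succ n)
    simp only [map_nsmul, map_sum, Derivation.leibniz, smul_eq_mul, sum_add_distrib] at D_succ
    simp only [coeff_derivative, map_add, coeff_mul, coeff_mk, ← Nat.cast_succ]
    rw [mul_comm, ← nsmul_eq_mul, D_succ, add_comm]
    simp only [mul_comm]
  have derivative_X_mul : derivative R (X * PowerSeries.mk z) = mk fun i => D (q i) := by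
    ext n
    rw [coeff_derivative, coeff_succ_X_mul, coeff_mk, coeff_mk, hz, nsmul_eq_mul, Nat.cast_succ,
      mul_comm]
  have derivative_mk := (isExp_iff_derivative_mk.1 hg).2
  have eq_zero : (mk fun n => D (g n)) - X * PowerSeries.mk z * PowerSeries.mk g = 0 := by
    refine eq_zero_of_derivative_eq_mul (Q := mk q) ?_ ?_
    · rw [map_sub, derivative_D, Derivation.leibniz _ (X * PowerSeries.mk z), derivative_X_mul,
        derivative_mk]
      simp only [smul_eq_mul]
      ring
    · rw [← coeff_zero_eq_constantCoeff_apply, map_sub, coeff_mk, hg.zero, D.map_one_eq_zero,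
        mul_assoc, coeff_zero_X_mul, sub_zero]
  have coeff_succ := congr_arg (coeff (n + 1)) (sub_eq_zero.1 eq_zero)
  rw [mul_assoc, coeff_succ_X_mul, coeff_mul] at coeff_succ
  simpa only [coeff_mk] using coeff_succ

end IsExp

theorem isExp_pow (x : R) : IsExp (fun i => x ^ (i + 1)) fun n => x ^ n where
  zero := pow_zero x
  succ n := by
    rw [sum_congr rfl (g := fun _ => x ^ (n + 1)), sum_const, Nat.card_antidiagonal]
    intro ij hij
    rw [← pow_add, add_right_comm, HasAntidiagonal.mem_antidiagonal.1 hij]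

theorem IsExp.succ_of_sub_pow [IsAddTorsionFree R] {q g t : ℕ → R} {x : R}
    (ht : IsExp (fun i => q i - x ^ (i + 1)) t) (hg : IsExp q g) (n : ℕ) :
    t (n + 1) = g (n + 1) - x * g n := by
  have product : IsExp q fun n => ∑ ij ∈ antidiagonal n, x ^ ij.1 * t ij.2 := by
    simpa only [Pi.add_def, add_sub_cancel] using (isExp_pow x).mul ht
  simp only [hg.unique product]
  rw [Nat.sum_antidiagonal_succ, Finset.mul_sum, pow_zero, one_mul]
  simp only [pow_succ', mul_assoc, add_sub_cancel_right]

end LogDerivative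

section PowerSums

open MvPowerSeries Finsupp

variable {σ R : Type*}

open Classical in
theorem coeff_p (k : ℕ) (m : ℕ →₀ ℕ) :
    coeff m (p k) = if ∃ i, m = single i k then 1 else 0 := by
  change p k m = _
  simp only [p]

theorem coeff_h (n : ℕ) (m : ℕ →₀ ℕ) : coeff m (h n) = if m.degree = n then 1 else 0 := rfl

open Classical in
theorem coeff_e (n : ℕ) (m : ℕ →₀ ℕ) :
    coeff m (e n) = if m.degree = n ∧ ∀ i, m i ≤ 1 then 1 else 0 := by
  change e n m = _
  simp only [e]

theorem isHomogeneous_p (k : ℕ) : (p k).IsHomogeneous k := by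
  classical
  intro m hm
  rw [coeff_p, ne_eq, ite_eq_right_iff, not_forall] at hm
  obtain ⟨⟨i, rfl⟩, -⟩ := hm
  rw [weight_single, Pi.one_apply, nsmul_one, Nat.cast_id]

theorem isHomogeneous_prod_p (s : Multiset ℕ) : (s.map p).prod.IsHomogeneous s.sum := by
  induction s using Multiset.induction_on with
  | empty => exact isHomogeneous_one
  | cons k s ih =>
    rw [Multiset.map_cons, Multiset.prod_cons, Multiset.sum_cons]
    exact IsHomogeneous.mul (isHomogeneous_p k) ih

open Classical in
theorem expand_p {k : ℕ} (hk : k ≠ 0) (j : ℕ) : expand k hk (p j) = p (k * j) := by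
  ext m
  by_cases hm : m ∈ Set.range fun m' : ℕ →₀ ℕ => k • m'
  · obtain ⟨m', rfl⟩ := hm
    rw [coeff_expand_smul, coeff_p, coeff_p]
    refine if_congr (exists_congr fun i => ?_) rfl rfl
    rw [← smul_eq_mul, ← smul_single]
    exact (nsmul_right_injective hk).eq_iff.symm
  · rw [coeff_expand_of_notMem_range hk _ hm, coeff_p, if_neg]
    rintro ⟨i, rfl⟩
    exact hm ⟨single i j, smul_single _ _ _⟩

theorem coeff_p_mul {k : ℕ} (hk : k ≠ 0) (f : Series) (m : ℕ →₀ ℕ) :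
    coeff m (p k * f) = ∑ i ∈ m.support with k ≤ m i, coeff (m - single i k) f := by
  classical
  rw [coeff_mul]
  simp only [coeff_p, ite_mul, one_mul, zero_mul]
  rw [← sum_filter]
  symm
  refine sum_bij (fun i _ => (single i k, m - single i k)) (fun i hi => ?_) ?_ ?_ fun _ _ => rfl
  · rw [mem_filter] at hi ⊢
    refine ⟨HasAntidiagonal.mem_antidiagonal.2 ?_, i, rfl⟩
    exact add_tsub_cancel_of_le (single_le_iff.2 hi.2)
  · intro i _ j _ hij
    exact (single_left_inj hk).1 (Prod.ext_iff.1 hij).1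
  · rintro ⟨_, b⟩ hab
    rw [mem_filter, HasAntidiagonal.mem_antidiagonal] at hab
    obtain ⟨rfl, i, rfl⟩ := hab
    refine ⟨i, ?_, by rw [add_tsub_cancel_left]⟩
    rw [mem_filter, mem_support_iff, Finsupp.add_apply, single_eq_same]
    omega

theorem degree_tsub_single {m : σ →₀ ℕ} {i : σ} {k : ℕ} (hk : k ≤ m i) :
    (m - single i k).degree + k = m.degree := by
  conv_rhs => rw [← tsub_add_cancel_of_le (single_le_iff.2 hk), map_add, degree_single]

theorem isExp_h : IsExp (fun i => p (i + 1)) h where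
  zero := by
    classical
    ext m
    simp only [coeff_h, coeff_one, degree_eq_zero_iff]
  succ n := by
    ext m
    have degree_eq_iff {i : ℕ} {jk : ℕ × ℕ} (hjk : jk ∈ antidiagonal n) (hi : jk.1 + 1 ≤ m i) :
        (m - single i (jk.1 + 1)).degree = jk.2 ↔ m.degree = n + 1 := by
      rw [HasAntidiagonal.mem_antidiagonal] at hjk
      have := degree_tsub_single hi
      omega
    have card_eq {a : ℕ} (ha : a ≤ n + 1) : #{jk ∈ antidiagonal n | jk.1 + 1 ≤ a} = a := by
      rw [card_filter, Nat.sum_antidiagonal_eq_sum_range_succ_mk, ← card_filter]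
      convert card_range a using 2
      grind
    rw [map_sum, map_nsmul, coeff_h]
    simp only [coeff_p_mul (Nat.succ_ne_zero _), coeff_h, sum_filter]
    rw [Finset.sum_comm]
    trans ∑ i ∈ m.support, ∑ jk ∈ antidiagonal n,
      if jk.1 + 1 ≤ m i then if m.degree = n + 1 then 1 else 0 else 0
    · by_cases hm : m.degree = n + 1
      · simp only [if_pos hm, ← sum_filter, sum_const]
        rw [← hm, degree_apply, ← sum_nsmul_assoc]
        exact Finset.sum_congr rfl fun i _ => by rw [card_eq (hm ▸ le_degree i m)]
      · simp only [if_neg hm, ite_self, sum_const_zero, smul_zero]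
    · refine Finset.sum_congr rfl fun i _ => Finset.sum_congr rfl fun jk hjk => ?_
      split_ifs <;> grind

theorem ext_killCompl {R : Type*} [CommSemiring R] {f g : MvPowerSeries ℕ R}
    (hfg : ∀ N, killCompl (Fin.valEmbedding (n := N)) f = killCompl Fin.valEmbedding g) :
    f = g := by
  ext m
  obtain ⟨N, hN⟩ : ∃ N, m.support ⊆ range N := m.support.exists_nat_subset_range
  have range_subset : ↑m.support ⊆ Set.range (Fin.valEmbedding (n := N)) := fun i hi =>
    ⟨⟨i, mem_range.1 (hN hi)⟩, rfl⟩
  rw [← embDomain_comapDomain range_subset]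
  exact congr_arg (coeff (m.comapDomain Fin.val Fin.val_injective.injOn)) (hfg N)

theorem coeff_esymm [Fintype σ] [CommSemiring R] (k : ℕ) (m : σ →₀ ℕ) :
    (MvPolynomial.esymm σ R k).coeff m = if m.degree = k ∧ ∀ i, m i ≤ 1 then 1 else 0 := by
  classical
  have sum_single_eq_iff (t : Finset σ) :
      ∑ i ∈ t, single i 1 = m ↔ m.support = t ∧ ∀ i, m i ≤ 1 := by
    simp only [Finsupp.ext_iff, Finset.ext_iff, finsetSum_apply, single_apply,
      Finset.sum_ite_eq', Finsupp.mem_support_iff]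
    grind
  rw [MvPolynomial.esymm_eq_sum_monomial, MvPolynomial.coeff_sum]
  simp only [MvPolynomial.coeff_monomial, sum_single_eq_iff]
  by_cases hm : ∀ i, m i ≤ 1
  · have degree_eq_card : m.degree = #m.support := by
      rw [degree_apply, card_eq_sum_ones]
      refine Finset.sum_congr rfl fun i hi => (hm i).antisymm ?_
      exact Nat.one_le_iff_ne_zero.2 (Finsupp.mem_support_iff.1 hi)
    simp only [and_iff_left hm, Finset.sum_ite_eq, mem_powersetCard_univ, degree_eq_card]
  · simp only [hm, and_false, if_false, sum_const_zero]

theorem killCompl_e (N k : ℕ) : killCompl (R := ℂ) (Fin.valEmbedding (n := N)) (e k) =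
    (MvPolynomial.esymm (Fin N) ℂ k : MvPowerSeries (Fin N) ℂ) := by
  classical
  ext m
  have degree_embDomain : (m.embDomain Fin.valEmbedding).degree = m.degree := by
    simp only [degree_apply, support_embDomain, sum_map, embDomain_apply_self]
  have embDomain_le_one : (∀ i, m.embDomain Fin.valEmbedding i ≤ 1) ↔ ∀ i, m i ≤ 1 := by
    refine ⟨fun hm i => ?_, fun hm i => ?_⟩
    · simpa only [embDomain_apply_self] using hm (Fin.valEmbedding i)
    · by_cases hi : i ∈ Set.range (Fin.valEmbedding (n := N))
      · obtain ⟨j, rfl⟩ := hi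
        exact (embDomain_apply_self ..).trans_le (hm j)
      · exact (embDomain_of_notMem_range _ _ _ hi).trans_le zero_le_one
  rw [coeff_killCompl, MvPolynomial.coeff_coe, coeff_esymm, coeff_e]
  simp only [degree_embDomain, embDomain_le_one]
  congr

theorem isExp_esymm [Fintype σ] [CommRing R] :
    IsExp (fun i => (-1) ^ i * MvPolynomial.psum σ R (i + 1)) (MvPolynomial.esymm σ R) where
  zero := MvPolynomial.esymm_zero σ R
  succ n := by
    rw [nsmul_eq_mul, MvPolynomial.mul_esymm_eq_sum, sum_filter, Nat.sum_antidiagonal_succ',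
      if_neg (lt_irrefl _), zero_add, ← Nat.sum_antidiagonal_swap, Finset.mul_sum]
    refine Finset.sum_congr rfl fun ij hij => ?_
    rw [HasAntidiagonal.mem_antidiagonal] at hij
    have neg_one_pow : (-1 : MvPolynomial σ R) ^ (n + 1 + 1) = (-1) ^ ij.1 * (-1) ^ ij.2 := by
      rw [← hij]
      ring
    have neg_one_pow_mul_self : (-1 : MvPolynomial σ R) ^ ij.2 * (-1) ^ ij.2 = 1 := by
      rw [← mul_pow, neg_one_mul, neg_neg, one_pow]
    rw [if_pos (by simp only [Prod.fst_swap]; omega), neg_one_pow]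
    simp only [Prod.fst_swap, Prod.snd_swap]
    linear_combination (-1) ^ ij.1 * MvPolynomial.esymm σ R ij.2 *
      MvPolynomial.psum σ R (ij.1 + 1) * neg_one_pow_mul_self

theorem isExp_e : IsExp (fun i => (-1) ^ i * p (i + 1)) e where
  zero := by
    refine ext_killCompl fun N => ?_
    rw [killCompl_e, MvPolynomial.esymm_zero, MvPolynomial.coe_one, map_one]
  succ n := by
    refine ext_killCompl fun N => ?_
    have newton := (isExp_esymm.map (MvPolynomial.coeToMvPowerSeries.ringHom (σ := Fin N)
      (R := ℂ))).succ n
    simpa only [Function.comp_apply, map_nsmul, map_sum, map_mul, map_pow, map_neg, map_one,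
      MvPolynomial.coeToMvPowerSeries.ringHom_apply, ← killCompl_e, ← killCompl_p] using newton

end PowerSums

section DegreeSums

open MvPowerSeries

variable {σ R : Type*} [CommRing R]

/-- The part of degree `n` of the infinite sum `∑ k, F k` of series with `k ≤ (F k).order`, to
which only the terms with `k ≤ n` contribute. -/
def sumComponent (F : ℕ → MvPowerSeries σ R) (n : ℕ) : MvPowerSeries σ R :=
  ∑ k ∈ range (n + 1), homogeneousComponent n (F k)

theorem sumComponent_zero_of_eq_one {F : ℕ → MvPowerSeries σ R} (hF : F 0 = 1) :
    sumComponent F 0 = 1 := by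
  rw [sumComponent, sum_range_one, hF, homogeneousComponent_of_isHomogeneous isHomogeneous_one,
    if_pos rfl]

theorem sumComponent_mul {F G : ℕ → MvPowerSeries σ R} (hF : ∀ k : ℕ, k ≤ (F k).order)
    (hG : ∀ k : ℕ, k ≤ (G k).order) (n : ℕ) :
    sumComponent (fun k => ∑ ij ∈ antidiagonal k, F ij.1 * G ij.2) n =
      ∑ ab ∈ antidiagonal n, sumComponent F ab.1 * sumComponent G ab.2 := by
  simp only [sumComponent, map_sum, homogeneousComponent_mul, sum_mul_sum]
  rw [sum_sigma', Finset.sum_comm]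
  refine Finset.sum_congr rfl fun ab hab => ?_
  rw [HasAntidiagonal.mem_antidiagonal] at hab
  rw [← sum_product']
  symm
  refine sum_of_injOn (fun ij => ⟨ij.1 + ij.2, ij⟩) (fun _ _ _ _ h => by aesop)
    (fun ij hij => ?_) (fun x hx hx' => ?_) fun _ _ => rfl
  · simp only [coe_product, coe_range, Set.mem_prod, Set.mem_Iio] at hij
    simp only [mem_coe, mem_sigma, mem_range, HasAntidiagonal.mem_antidiagonal, and_true]
    omega
  · obtain ⟨k, i, j⟩ := x
    simp only [mem_sigma, mem_range, HasAntidiagonal.mem_antidiagonal] at hx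
    obtain ⟨-, rfl⟩ := hx
    have lt : ab.1 < i ∨ ab.2 < j := by
      by_contra! h
      exact hx' ⟨(i, j), by simpa [Nat.lt_succ_iff] using h, rfl⟩
    rcases lt with lt | lt
    · rw [homogeneousComponent_eq_zero_of_lt (hF i) lt, zero_mul]
    · rw [homogeneousComponent_eq_zero_of_lt (hG j) lt, mul_zero]

instance [IsAddTorsionFree R] : IsAddTorsionFree (MvPowerSeries σ R) :=
  inferInstanceAs (IsAddTorsionFree ((σ →₀ ℕ) → R))

theorem le_order_of_nsmul [IsAddTorsionFree R] {f : MvPowerSeries σ R} {k d : ℕ} (hk : k ≠ 0)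
    (hf : d ≤ (k • f).order) : d ≤ f.order := by
  refine nat_le_order fun m hm => (nsmul_eq_zero_iff_right hk).1 ?_
  rw [← map_nsmul]
  exact coeff_of_lt_order (lt_of_lt_of_le (by exact_mod_cast hm) hf)

theorem le_order_euler {f : MvPowerSeries σ R} {d : ℕ} (hf : d ≤ f.order) :
    d ≤ (euler f).order := by
  refine nat_le_order fun m hm => ?_
  rw [coeff_euler, coeff_of_lt_order (lt_of_lt_of_le (by exact_mod_cast hm) hf), smul_zero]

theorem le_order_sum {ι : Type*} {s : Finset ι} {f : ι → MvPowerSeries σ R} {d : ℕ}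
    (hf : ∀ i ∈ s, d ≤ (f i).order) : d ≤ (∑ i ∈ s, f i).order := by
  refine nat_le_order fun m hm => ?_
  rw [map_sum]
  exact sum_eq_zero fun i hi => coeff_of_lt_order (lt_of_lt_of_le (by exact_mod_cast hm) (hf i hi))

theorem IsExp.le_order [IsAddTorsionFree R] {q g : ℕ → MvPowerSeries σ R} (hg : IsExp q g)
    (hq : ∀ i : ℕ, (i + 1 : ℕ) ≤ (q i).order) (k : ℕ) : k ≤ (g k).order := by
  induction k using Nat.strong_induction_on with
  | _ k ih =>
    rcases k with _ | k
    · exact zero_le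
    refine le_order_of_nsmul k.succ_ne_zero (hg.succ k ▸ le_order_sum fun ij hij => ?_)
    rw [HasAntidiagonal.mem_antidiagonal] at hij
    refine le_trans ?_ le_order_mul
    rw [← hij, add_right_comm, Nat.cast_add]
    exact add_le_add (hq ij.1) (ih ij.2 (by omega))

/-- The Euler derivation multiplies the part of degree `n` by `n`, so the recursion for
`euler (g k)` becomes, degree by degree, Newton's recursion for the components of `∑ k, g k`. -/
theorem IsExp.sumComponent [IsAddTorsionFree R] {q z g : ℕ → MvPowerSeries σ R} (hg : IsExp q g)
    (hqz : ∀ i, euler (q i) = (i + 1) • z i) (hq : ∀ i : ℕ, (i + 1 : ℕ) ≤ (q i).order) :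
    IsExp (fun n => ∑ i ∈ range (n + 1), homogeneousComponent (n + 1) (z i))
      (sumComponent g) where
  zero := sumComponent_zero_of_eq_one hg.zero
  succ n := by
    let F : ℕ → MvPowerSeries σ R
      | 0 => 0
      | k + 1 => z k
    have F_zero : F 0 = 0 := rfl
    have euler_g (k : ℕ) : euler (g k) = ∑ ij ∈ antidiagonal k, F ij.1 * g ij.2 := by
      rcases k with _ | k
      · rw [hg.zero, Derivation.map_one_eq_zero, Nat.antidiagonal_zero, sum_singleton, F_zero,
          zero_mul]
      · rw [hg.derivation_apply_succ euler hqz, Nat.sum_antidiagonal_succ, F_zero, zero_mul,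
          zero_add]
    have le_order_F (k : ℕ) : k ≤ (F k).order := by
      rcases k with _ | k
      · exact zero_le
      · exact le_order_of_nsmul k.succ_ne_zero (hqz k ▸ le_order_euler (hq k))
    have sumComponent_F (a : ℕ) : SymFn.sumComponent F (a + 1) =
        ∑ i ∈ range (a + 1), homogeneousComponent (a + 1) (z i) := by
      rw [SymFn.sumComponent, sum_range_succ', F_zero, map_zero, add_zero]
    calc (n + 1) • SymFn.sumComponent g (n + 1)
      _ = SymFn.sumComponent (fun k => ∑ ij ∈ antidiagonal k, F ij.1 * g ij.2) (n + 1) := by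
        simp only [SymFn.sumComponent, smul_sum, ← homogeneousComponent_euler, euler_g]
      _ = _ := by
        rw [sumComponent_mul le_order_F (hg.le_order hq), Nat.sum_antidiagonal_succ]
        simp only [sumComponent_F]
        rw [SymFn.sumComponent, sum_range_one, F_zero, map_zero, zero_mul, zero_add]

end DegreeSums

section Plethysm

open MvPolynomial

/-- The polynomials `g_n` in the variables `X_0, X_1, …` with
`(n + 1) g_{n+1} = ∑_{i+j=n} c_i X_i g_j`. Substituting `p_{i+1}` for `X_i` gives `h_n` when
`c_i = 1`, and `e_n` when `c_i = (-1) ^ i`. -/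
def newtonPoly (c : ℕ → ℂ) : ℕ → MvPolynomial ℕ ℂ
  | 0 => 1
  | n + 1 => ((n + 1 : ℕ) : ℂ)⁻¹ • ∑ i : Fin (n + 1), (c i • X (i : ℕ)) * newtonPoly c (n - i)
  decreasing_by omega

theorem isExp_newtonPoly (c : ℕ → ℂ) :
    IsExp (fun i => c i • (X i : MvPolynomial ℕ ℂ)) (newtonPoly c) where
  zero := newtonPoly.eq_1 c
  succ n := by
    rw [newtonPoly, ← Nat.cast_smul_eq_nsmul ℂ, smul_inv_smul₀ (by exact_mod_cast n.succ_ne_zero),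
      Nat.sum_antidiagonal_eq_sum_range_succ_mk, Finset.sum_range]

theorem isExp_aeval_newtonPoly {R : Type*} [CommRing R] [Algebra ℂ R] (c : ℕ → ℂ) (y : ℕ → R) :
    IsExp (fun i => c i • y i) fun n => aeval y (newtonPoly c n) := by
  simpa only [Function.comp_def, RingHom.coe_coe, map_smul, aeval_X] using
    (isExp_newtonPoly c).map ((aeval y : MvPolynomial ℕ ℂ →ₐ[ℂ] R) : MvPolynomial ℕ ℂ →+* R)

theorem neg_one_pow_smul {R : Type*} [Ring R] [Algebra ℂ R] (k : ℕ) (f : R) :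
    (-1 : ℂ) ^ k • f = (-1) ^ k * f := by
  rw [Algebra.smul_def, map_pow, map_neg, map_one]

theorem aeval_newtonPoly_h (n : ℕ) : aeval (fun k => p (k + 1)) (newtonPoly 1 n) = h n := by
  refine congr_fun (IsExp.unique (isExp_aeval_newtonPoly _ _) ?_) n
  simpa only [Pi.one_apply, one_smul] using isExp_h

theorem aeval_newtonPoly_e (n : ℕ) :
    aeval (fun k => p (k + 1)) (newtonPoly (fun i => (-1) ^ i) n) = e n := by
  refine congr_fun (IsExp.unique (isExp_aeval_newtonPoly _ _) ?_) n
  simpa only [neg_one_pow_smul] using isExp_e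

theorem plethysm_h (n : ℕ) (f : Series) : plethysm (h n) f =
    aeval (fun k : ℕ => MvPowerSeries.expand (k + 1) k.succ_ne_zero f) (newtonPoly 1 n) := by
  rw [plethysm, ← aeval_newtonPoly_h, toPowerSums_aeval]

theorem plethysm_e (n : ℕ) (f : Series) : plethysm (e n) f =
    aeval (fun k : ℕ => MvPowerSeries.expand (k + 1) k.succ_ne_zero f)
      (newtonPoly (fun i => (-1) ^ i) n) := by
  rw [plethysm, ← aeval_newtonPoly_e, toPowerSums_aeval]

theorem isExp_plethysm_h (f : Series) :
    IsExp (fun i => MvPowerSeries.expand (i + 1) i.succ_ne_zero f) fun n => plethysm (h n) f := by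
  simpa only [← plethysm_h, Pi.one_apply, one_smul] using isExp_aeval_newtonPoly 1
    fun k : ℕ => MvPowerSeries.expand (k + 1) k.succ_ne_zero f

theorem isExp_plethysm_e (f : Series) :
    IsExp (fun i => (-1) ^ i * MvPowerSeries.expand (i + 1) i.succ_ne_zero f)
      fun n => plethysm (e n) f := by
  simpa only [← plethysm_e, neg_one_pow_smul] using isExp_aeval_newtonPoly (fun i => (-1) ^ i)
    fun k : ℕ => MvPowerSeries.expand (k + 1) k.succ_ne_zero f

end Plethysm

/-! ### Power sum expansions of the induced characters -/

section InducedCharacters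

theorem trace_eq_card_fixedPoints {R X V : Type*} [CommRing R] [Fintype X] [DecidableEq X]
    [AddCommGroup V] [Module R V] (b : Module.Basis X R V) (f : X → X) (T : V →ₗ[R] V)
    (hT : ∀ x, T (b x) = b (f x)) :
    LinearMap.trace R V T = (#{x | f x = x} : R) := by
  rw [LinearMap.trace_eq_matrix_trace R b, Matrix.trace]
  simp [LinearMap.toMatrix_apply, hT, Finsupp.single_apply]

variable {k : Type*} [Field k]

open Representation in
theorem trace_coinvariants {G V : Type*} [Group G] [Fintype G] (hG : (Fintype.card G : k) ≠ 0)
    [AddCommGroup V] [Module k V] [Module.Finite k V] (ρ : Representation k G V) (T : V →ₗ[k] V)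
    (T' : ρ.Coinvariants →ₗ[k] ρ.Coinvariants)
    (hT : T' ∘ₗ Coinvariants.mk ρ = Coinvariants.mk ρ ∘ₗ T) :
    LinearMap.trace k _ T' = (Fintype.card G : k)⁻¹ * ∑ g, LinearMap.trace k V (T ∘ₗ ρ g) := by
  let average : V →ₗ[k] V := (Fintype.card G : k)⁻¹ • ∑ g, ρ g
  have average_comp (g : G) : average ∘ₗ ρ g = average := by
    ext v
    simp only [average, LinearMap.comp_apply, LinearMap.smul_apply, LinearMap.sum_apply]
    congr 1
    exact Fintype.sum_equiv (Equiv.mulRight g) _ _ fun x => by simp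
  let s := Coinvariants.lift ρ average average_comp
  have mk_comp_s : Coinvariants.mk ρ ∘ₗ s = LinearMap.id := by
    ext v
    simp [s, average, map_sum, ← Nat.cast_smul_eq_nsmul k, smul_smul, hG]
  calc LinearMap.trace k _ T'
    _ = LinearMap.trace k _ (Coinvariants.mk ρ ∘ₗ (T ∘ₗ s)) := by
      rw [← LinearMap.comp_assoc, ← hT, LinearMap.comp_assoc, mk_comp_s, LinearMap.comp_id]
    _ = LinearMap.trace k V (T ∘ₗ average) := LinearMap.trace_comp_comm' ..
    _ = _ := by
      simp only [average, LinearMap.comp_smul, map_smul, smul_eq_mul, ← map_sum]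
      congr 2
      ext v
      simp only [LinearMap.comp_apply, LinearMap.sum_apply, map_sum]

theorem trace_ind {G H W : Type*} [Group G] [Fintype G] (hG : (Fintype.card G : k) ≠ 0) [Group H]
    [Fintype H] [DecidableEq H] [AddCommGroup W] [Module k W] [Module.Finite k W] (φ : G →* H)
    (χ : Representation k G W) (s : H) :
    LinearMap.trace k _ (Representation.ind φ χ s) = (Fintype.card G : k)⁻¹ *
      ∑ g, (#{x | φ g * x * s⁻¹ = x} : k) * LinearMap.trace k W (χ g) := by
  let b : Module.Basis H k (MonoidAlgebra k H) := ⟨MonoidAlgebra.coeffLinearEquiv k⟩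
  have : Module.Finite k (MonoidAlgebra k H) := .of_basis b
  let T : MonoidAlgebra k H →ₗ[k] MonoidAlgebra k H :=
    MonoidAlgebra.mapDomainLinearMap k k fun x => x * s⁻¹
  rw [trace_coinvariants hG _ (T.rTensor W) _ rfl]
  congr 1
  refine sum_congr rfl fun g _ => ?_
  have map_comp : T.rTensor W ∘ₗ
      (Representation.tprod ((Representation.leftRegular k H).comp φ) χ) g =
        TensorProduct.map (T ∘ₗ Representation.leftRegular k H (φ g)) (χ g) := by
    ext; simp
  rw [map_comp, LinearMap.trace_tensorProduct']
  congr 1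
  have b_apply (x : H) : b x = MonoidAlgebra.single x 1 := rfl
  exact trace_eq_card_fixedPoints b _ _ fun x => by simp [b_apply, T]

end InducedCharacters

section Permutations

variable {α : Type*} [Fintype α] [DecidableEq α]

/-- The product of power sums `p_{λ(σ)}`, where `λ(σ)` is the cycle type of `σ`. -/
def cyclePowerSum (σ : Equiv.Perm α) : Series :=
  (σ.partition.parts.map p).prod

theorem cyclePowerSum_eq_of_isConj {σ τ : Equiv.Perm α} (h : IsConj σ τ) :
    cyclePowerSum σ = cyclePowerSum τ := by
  rw [cyclePowerSum, cyclePowerSum, Equiv.Perm.partition_eq_of_isConj.1 h]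

theorem sum_card_conjugators_smul_cyclePowerSum (τ : Equiv.Perm α) :
    ∑ σ, (#{x | τ * x * σ⁻¹ = x} : ℂ) • cyclePowerSum σ =
      ((Fintype.card α).factorial : ℂ) • cyclePowerSum τ := by
  have unique_conjugate (x : Equiv.Perm α) :
      ∑ σ, (if τ * x * σ⁻¹ = x then cyclePowerSum σ else 0) = cyclePowerSum τ := by
    rw [sum_eq_single (x⁻¹ * τ * x) (fun σ _ hσ => if_neg fun h => hσ ?_) (by simp)]
    · rw [if_pos (by group)]
      exact (cyclePowerSum_eq_of_isConj (isConj_iff.2 ⟨x⁻¹, by group⟩)).symm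
    · rw [mul_assoc, eq_inv_mul_iff_mul_eq, ← mul_inv_eq_iff_eq_mul.1 h]
  simp_rw [Nat.cast_smul_eq_nsmul, ← sum_const, sum_filter]
  rw [Finset.sum_comm, Finset.sum_congr rfl fun x _ => unique_conjugate x, sum_const, card_univ,
    Fintype.card_perm]

theorem frobeniusChar_ind {G β W : Type} [Group G] [Fintype G] [Fintype β] [DecidableEq β]
    [AddCommGroup W] [Module ℂ W] [Module.Finite ℂ W] (φ : G →* Equiv.Perm β)
    (χ : Representation ℂ G W) :
    frobeniusChar (Representation.ind φ χ) = (Fintype.card G : ℂ)⁻¹ •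
      ∑ g, LinearMap.trace ℂ W (χ g) • cyclePowerSum (φ g) := by
  have hG : (Fintype.card G : ℂ) ≠ 0 := by exact_mod_cast Fintype.card_ne_zero
  have hβ : ((Fintype.card β).factorial : ℂ) ≠ 0 := by exact_mod_cast Nat.factorial_ne_zero _
  calc frobeniusChar (Representation.ind φ χ)
    _ = ((Fintype.card β).factorial : ℂ)⁻¹ • ∑ σ, ∑ g, (Fintype.card G : ℂ)⁻¹ •
        LinearMap.trace ℂ W (χ g) • (#{x | φ g * x * σ⁻¹ = x} : ℂ) • cyclePowerSum σ := by
      simp only [frobeniusChar, trace_ind hG, mul_smul, sum_smul, ← smul_sum, cyclePowerSum,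
        smul_comm (LinearMap.trace ℂ W _)]
    _ = _ := by
      simp only [Finset.sum_comm (s := (univ : Finset (Equiv.Perm β))), ← smul_sum,
        sum_card_conjugators_smul_cyclePowerSum]
      rw [smul_comm, smul_sum]
      simp only [smul_comm (LinearMap.trace ℂ W _), inv_smul_smul₀ hβ]

theorem cycleType_of_free {σ : Equiv.Perm α}
    (hσ : ∀ (k : ℕ) (x : α), (σ ^ k) x = x → σ ^ k = 1) {k : ℕ} (hk : k ∈ σ.cycleType) :
    k = orderOf σ := by
  refine Nat.dvd_antisymm (Equiv.Perm.dvd_of_mem_cycleType hk) ?_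
  rw [Equiv.Perm.cycleType_def, Multiset.mem_map] at hk
  obtain ⟨c, hc, rfl⟩ := hk
  obtain ⟨x, hx⟩ := (Equiv.Perm.mem_cycleFactorsFinset_iff.1 hc).1.nonempty_support
  refine orderOf_dvd_of_pow_eq_one (hσ _ x ?_)
  rw [Function.comp_apply, ← (Equiv.Perm.mem_cycleFactorsFinset_iff.1 hc).1.orderOf,
    ← Equiv.Perm.cycleOf_pow_apply_self, ← Equiv.Perm.cycle_is_cycleOf hx hc, pow_orderOf_eq_one,
    Equiv.Perm.one_apply]

theorem partition_parts_of_free [Nonempty α] {σ : Equiv.Perm α}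
    (hσ : ∀ (k : ℕ) (x : α), (σ ^ k) x = x → σ ^ k = 1) :
    σ.partition.parts = Multiset.replicate (Fintype.card α / orderOf σ) (orderOf σ) := by
  rw [Equiv.Perm.parts_partition]
  by_cases one : σ = 1
  · simp [one]
  have support_eq : σ.support = univ := eq_univ_iff_forall.2 fun x =>
    Equiv.Perm.mem_support.2 fun hx => one (by simpa using hσ 1 x (by simpa using hx))
  have cycleType_eq := Multiset.eq_replicate_card.2 fun k => cycleType_of_free hσ (k := k)
  have card_mul : Multiset.card σ.cycleType * orderOf σ = Fintype.card α := by
    have := Equiv.Perm.sum_cycleType σ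
    rwa [cycleType_eq, Multiset.sum_replicate, support_eq, card_univ, smul_eq_mul] at this
  rw [support_eq, card_univ, Nat.sub_self, Multiset.replicate_zero, add_zero, cycleType_eq,
    ← card_mul, Nat.mul_div_cancel _ (orderOf_pos σ)]

end Permutations

section CyclicGroups

theorem cyclicEmbedding_apply (n : ℕ) (a : Multiplicative (ZMod n)) (x : ZMod n) :
    cyclicEmbedding n a x = a.toAdd + x := rfl

theorem cyclicEmbedding_injective (n : ℕ) : Function.Injective (cyclicEmbedding n) := by
  intro a b hab
  simpa only [cyclicEmbedding_apply, add_zero, EmbeddingLike.apply_eq_iff_eq] using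
    Equiv.congr_fun hab 0

theorem cyclePowerSum_cyclicEmbedding {n : ℕ} [NeZero n] (a : Multiplicative (ZMod n)) :
    cyclePowerSum (cyclicEmbedding n a) = p (orderOf a) ^ (n / orderOf a) := by
  rw [cyclePowerSum, partition_parts_of_free,
    orderOf_injective (cyclicEmbedding n) (cyclicEmbedding_injective n), Multiset.map_replicate,
    Multiset.prod_replicate, ZMod.card]
  intro k x hx
  rw [← map_pow, cyclicEmbedding_apply, add_eq_right, toAdd_eq_zero] at hx
  rw [← map_pow, hx, map_one]

theorem trace_cyclicRep {n : ℕ} [NeZero n] (r : ℕ) (a : Multiplicative (ZMod n)) :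
    LinearMap.trace ℂ ℂ (cyclicRep n r a) = (ZMod.stdAddChar a.toAdd : ℂ) ^ r := by
  have : cyclicRep n r a = (ZMod.stdAddChar a.toAdd : ℂ) ^ r • LinearMap.id := by ext; rfl
  rw [this, map_smul, LinearMap.trace_id, Module.finrank_self, Nat.cast_one, smul_eq_mul, mul_one]

theorem orderOf_stdAddChar {n : ℕ} [NeZero n] (a : Multiplicative (ZMod n)) :
    orderOf (ZMod.stdAddChar a.toAdd : ℂ) = orderOf a :=
  orderOf_injective (ZMod.stdAddChar (N := n)).toMonoidHom
    (fun _ _ h => ZMod.injective_stdAddChar h) a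

theorem sum_stdAddChar_eq_sum_divisors {M : Type*} [AddCommMonoid M] (n : ℕ) [NeZero n]
    (f : ℂ → M) : ∑ a : ZMod n, f (ZMod.stdAddChar a) =
      ∑ d ∈ n.divisors, ∑ ζ ∈ primitiveRoots d ℂ, f ζ := by
  have hn : 0 < n := Nat.pos_of_ne_zero (NeZero.ne n)
  have image_eq : univ.image (fun a : ZMod n => (ZMod.stdAddChar a : ℂ)) =
      Polynomial.nthRootsFinset n (1 : ℂ) := by
    refine eq_of_subset_of_card_le (image_subset_iff.2 fun a _ => ?_) ?_
    · rw [Polynomial.mem_nthRootsFinset hn, ← AddChar.map_nsmul_eq_pow, nsmul_eq_mul,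
        ZMod.natCast_self, zero_mul, AddChar.map_zero_eq_one]
    · rw [card_image_of_injective _ ZMod.injective_stdAddChar, card_univ, ZMod.card,
        (Complex.isPrimitiveRoot_exp n hn.ne').card_nthRootsFinset]
  rw [← sum_image (f := f) fun a _ b _ hab => ZMod.injective_stdAddChar hab, image_eq,
    IsPrimitiveRoot.nthRoots_one_eq_biUnion_primitiveRoots,
    sum_biUnion fun _ _ _ _ hab => IsPrimitiveRoot.disjoint hab]

/-- Ramanujan's sum `c_d(r)`, the sum of the `r`-th powers of the primitive `d`-th roots of
unity, as an arithmetic function of `d`. -/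
def ramanujanSum (r : ℕ) : ArithmeticFunction ℂ where
  toFun d := ∑ ζ ∈ primitiveRoots d ℂ, ζ ^ r
  map_zero' := by rw [primitiveRoots_zero, sum_empty]

theorem ramanujanSum_apply (r d : ℕ) : ramanujanSum r d = ∑ ζ ∈ primitiveRoots d ℂ, ζ ^ r := rfl

theorem sum_ramanujanSum (r : ℕ) {n : ℕ} (hn : n ≠ 0) :
    ∑ d ∈ n.divisors, ramanujanSum r d = if n ∣ r then (n : ℂ) else 0 := by
  have : NeZero n := ⟨hn⟩
  have pow_eq_one_iff : (ZMod.stdAddChar ^ r : AddChar (ZMod n) ℂ) = 1 ↔ n ∣ r := by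
    rw [AddChar.eq_one_iff]
    refine ⟨fun h => ?_, fun h a => ?_⟩
    · rw [← ZMod.natCast_eq_zero_iff]
      refine ZMod.injective_stdAddChar ?_
      rw [AddChar.map_zero_eq_one, ← nsmul_one, AddChar.map_nsmul_eq_pow]
      exact h 1
    · rw [AddChar.pow_apply, ← AddChar.map_nsmul_eq_pow, nsmul_eq_mul,
        (ZMod.natCast_eq_zero_iff r n).2 h, zero_mul, AddChar.map_zero_eq_one]
  simp only [ramanujanSum_apply]
  rw [← sum_stdAddChar_eq_sum_divisors n fun ζ => ζ ^ r]
  simp_rw [← AddChar.pow_apply, AddChar.sum_eq_ite, ← pow_eq_one_iff, ZMod.card,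
    AddChar.one_eq_zero]

theorem nsmul_cyclicIndChar (n r : ℕ) :
    n • cyclicIndChar n r = ∑ d ∈ n.divisors, ramanujanSum r d • p d ^ (n / d) := by
  rcases n with _ | n
  · rw [zero_smul, Nat.divisors_zero, sum_empty]
  let f (ζ : ℂ) : Series := ζ ^ r • p (orderOf ζ) ^ ((n + 1) / orderOf ζ)
  have term_eq (a : Multiplicative (ZMod (n + 1))) :
      LinearMap.trace ℂ ℂ (cyclicRep (n + 1) r a) • cyclePowerSum (cyclicEmbedding (n + 1) a) =
        f (ZMod.stdAddChar a.toAdd) := by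
    rw [trace_cyclicRep, cyclePowerSum_cyclicEmbedding, ← orderOf_stdAddChar]
  rw [cyclicIndChar, frobeniusChar_ind, Fintype.card_multiplicative, ZMod.card,
    ← Nat.cast_smul_eq_nsmul ℂ, smul_inv_smul₀ (by exact_mod_cast n.succ_ne_zero),
    Finset.sum_congr rfl fun a _ => term_eq a,
    Equiv.sum_comp Multiplicative.toAdd fun a : ZMod (n + 1) => f (ZMod.stdAddChar a),
    sum_stdAddChar_eq_sum_divisors (n + 1) f]
  refine Finset.sum_congr rfl fun d _ => ?_
  rw [ramanujanSum_apply, sum_smul]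
  refine Finset.sum_congr rfl fun ζ hζ => ?_
  simp only [f, ← (isPrimitiveRoot_of_mem_primitiveRoots hζ).eq_orderOf]

end CyclicGroups

section RamanujanSums

open ArithmeticFunction
open scoped ArithmeticFunction.zeta

theorem ramanujanSum_one_right (r : ℕ) : ramanujanSum r 1 = 1 := by
  rw [ramanujanSum_apply, IsPrimitiveRoot.primitiveRoots_one, sum_singleton, one_pow]

theorem ramanujanSum_congr {r s d : ℕ} (h : ∀ e, e ∣ d → (e ∣ r ↔ e ∣ s)) :
    ramanujanSum r d = ramanujanSum s d := by
  rcases d.eq_zero_or_pos with rfl | hd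
  · rw [ArithmeticFunction.map_zero, ArithmeticFunction.map_zero]
  have inversion (r : ℕ) := sum_eq_iff_sum_mul_moebius_eq.1
    fun n (hn : 0 < n) => sum_ramanujanSum r hn.ne'
  rw [← inversion r d hd, ← inversion s d hd]
  refine Finset.sum_congr rfl fun x hx => ?_
  rw [if_congr (h x.2 ((Nat.mem_divisorsAntidiagonal.1 hx).1 ▸ dvd_mul_left ..)) rfl rfl]

theorem dvd_two_pow_padicValNat_iff {e n : ℕ} (hn : n ≠ 0) (he : e ∣ n) :
    e ∣ 2 ^ padicValNat 2 n ↔ ∃ j, e = 2 ^ j := by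
  refine ⟨fun h => ((Nat.dvd_prime_pow Nat.prime_two).1 h).imp fun _ => And.right, ?_⟩
  rintro ⟨j, rfl⟩
  exact pow_dvd_pow 2 ((padicValNat_dvd_iff_le hn).1 he)

theorem ramanujanSum_two_pow_padicValNat {n d : ℕ} (hd : d ∈ n.divisors) :
    ramanujanSum (2 ^ padicValNat 2 n) d = ramanujanSum (2 ^ padicValNat 2 d) d := by
  refine ramanujanSum_congr fun e he => ?_
  rw [dvd_two_pow_padicValNat_iff (Nat.ne_zero_of_mem_divisors hd)
      (he.trans (Nat.dvd_of_mem_divisors hd)),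
    dvd_two_pow_padicValNat_iff (Nat.pos_of_mem_divisors hd).ne' he]

theorem zeta_mul_ramanujanSum_one : (ζ : ArithmeticFunction ℂ) * ramanujanSum 1 = 1 := by
  ext m
  rw [coe_zeta_mul_apply]
  rcases eq_or_ne m 0 with rfl | hm
  · rw [Nat.divisors_zero, sum_empty, ArithmeticFunction.map_zero]
  · simp only [sum_ramanujanSum 1 hm, Nat.dvd_one, one_apply]
    exact ite_congr rfl (fun h => by rw [h, Nat.cast_one]) fun _ => rfl

/-- The arithmetic function `k ↦ (-1) ^ (k - 1)`, for `k ≥ 1`: the signs in Newton's recursion for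
the elementary symmetric functions. -/
def altSign : ArithmeticFunction ℂ where
  toFun k := if k = 0 then 0 else (-1) ^ (k - 1)
  map_zero' := if_pos rfl

theorem altSign_succ (i : ℕ) : altSign (i + 1) = (-1) ^ i := rfl

theorem altSign_eq {k : ℕ} (hk : k ≠ 0) : altSign k = 1 - if 2 ∣ k then 2 else 0 := by
  obtain ⟨i, rfl⟩ := Nat.exists_eq_succ_of_ne_zero hk
  rw [altSign_succ]
  rcases Nat.even_or_odd i with hi | hi
  · rw [hi.neg_one_pow, if_neg (by grind), sub_zero]
  · rw [hi.neg_one_pow, if_pos (by grind)]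
    norm_num

/-- The character sum `c_d(2 ^ k)` of `Lie_d^{(2)}`, where `2 ^ k` is the largest power of `2`
dividing `d`. -/
def ramanujanSumTwo : ArithmeticFunction ℂ where
  toFun d := ramanujanSum (2 ^ padicValNat 2 d) d
  map_zero' := ArithmeticFunction.map_zero

open scoped Classical in
theorem sum_ramanujanSumTwo {n : ℕ} (hn : n ≠ 0) :
    ∑ d ∈ n.divisors, ramanujanSumTwo d = if ∃ j, n = 2 ^ j then (n : ℂ) else 0 := by
  rw [← if_congr (dvd_two_pow_padicValNat_iff hn dvd_rfl) rfl rfl, ← sum_ramanujanSum _ hn]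
  exact Finset.sum_congr rfl fun d hd => (ramanujanSum_two_pow_padicValNat hd).symm

theorem filter_two_dvd_divisorsAntidiagonal (l : ℕ) :
    {x ∈ (2 * l).divisorsAntidiagonal | 2 ∣ x.1} =
      l.divisorsAntidiagonal.image fun x => (2 * x.1, x.2) := by
  ext ⟨a, b⟩
  simp only [mem_filter, mem_image, Nat.mem_divisorsAntidiagonal, Prod.exists, Prod.mk.injEq]
  constructor
  · rintro ⟨⟨hab, hl⟩, a, rfl⟩
    exact ⟨a, b, ⟨by linarith, by omega⟩, rfl, rfl⟩
  · rintro ⟨a, b, ⟨rfl, hl⟩, rfl, rfl⟩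
    exact ⟨⟨mul_assoc .., by omega⟩, dvd_mul_right ..⟩

theorem sum_divisorsAntidiagonal_ite_two_dvd (f : ℕ → ℂ) (l : ℕ) :
    ∑ x ∈ (2 * l).divisorsAntidiagonal, (if 2 ∣ x.1 then f x.2 else 0) =
      ∑ d ∈ l.divisors, f d := by
  rw [← sum_filter, filter_two_dvd_divisorsAntidiagonal, sum_image (by simp +contextual),
    Nat.sum_divisorsAntidiagonal' (f := fun _ d => f d)]

open scoped Classical in
theorem altSign_mul_ramanujanSumTwo : altSign * ramanujanSumTwo = 1 := by
  ext m
  rcases eq_or_ne m 0 with rfl | hm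
  · rw [ArithmeticFunction.map_zero, ArithmeticFunction.map_zero]
  have altSign_mul_apply : (altSign * ramanujanSumTwo) m = ∑ d ∈ m.divisors, ramanujanSumTwo d -
      2 * ∑ x ∈ m.divisorsAntidiagonal, if 2 ∣ x.1 then ramanujanSumTwo x.2 else 0 := by
    rw [← Nat.sum_divisorsAntidiagonal' (f := fun _ d => ramanujanSumTwo d), mul_apply,
      Finset.mul_sum, ← sum_sub_distrib]
    refine Finset.sum_congr rfl fun x hx => ?_
    rw [altSign_eq (Nat.left_ne_zero_of_mem_divisorsAntidiagonal hx)]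
    split_ifs <;> ring
  rw [altSign_mul_apply, sum_ramanujanSumTwo hm, one_apply]
  rcases Nat.even_or_odd' m with ⟨l, rfl | rfl⟩
  · have two_mul_eq_two_pow : (∃ j, 2 * l = 2 ^ j) ↔ ∃ j, l = 2 ^ j := by
      refine ⟨fun ⟨j, hj⟩ => ?_, fun ⟨j, hj⟩ => ⟨j + 1, by rw [hj, pow_succ']⟩⟩
      rcases j with _ | j
      · omega
      · exact ⟨j, by rw [pow_succ'] at hj; omega⟩
    rw [sum_divisorsAntidiagonal_ite_two_dvd, sum_ramanujanSumTwo (by omega),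
      if_congr two_mul_eq_two_pow rfl rfl, if_neg (show 2 * l ≠ 1 by omega)]
    split_ifs <;> push_cast <;> ring
  · have even_terms : ∑ x ∈ (2 * l + 1).divisorsAntidiagonal,
        (if 2 ∣ x.1 then ramanujanSumTwo x.2 else 0) = 0 :=
      sum_eq_zero fun x hx => if_neg fun h => by
        have := h.trans ((Nat.mem_divisorsAntidiagonal.1 hx).1 ▸ dvd_mul_right x.1 x.2)
        omega
    have eq_two_pow : (∃ j, 2 * l + 1 = 2 ^ j) ↔ 2 * l + 1 = 1 := by
      refine ⟨fun ⟨j, hj⟩ => ?_, fun h => ⟨0, h⟩⟩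
      rcases j with _ | j
      · exact hj
      · rw [pow_succ'] at hj; omega
    rw [even_terms, mul_zero, sub_zero]
    exact ite_congr (propext eq_two_pow) (fun h => by rw [h, Nat.cast_one]) fun _ => rfl

end RamanujanSums

section CyclicSums

open ArithmeticFunction
open scoped ArithmeticFunction.zeta

theorem sum_range_ite_dvd {M : Type*} [AddCommMonoid M] (g : ℕ → ℕ → M) (n : ℕ) :
    ∑ i ∈ range n, (if i + 1 ∣ n then g (i + 1) (n / (i + 1)) else 0) =
      ∑ x ∈ n.divisorsAntidiagonal, g x.1 x.2 := by
  rw [Nat.sum_divisorsAntidiagonal, Nat.divisors, sum_filter, range_eq_Ico,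
    sum_Ico_add' (fun k => if k ∣ n then g k (n / k) else 0) 0 n 1, zero_add]

theorem sum_divisorsAntidiagonal_of_mul_eq_one {R M : Type*} [CommSemiring R] [AddCommMonoid M]
    [Module R M] {c ψ : ArithmeticFunction R} (hcψ : c * ψ = 1) (F : ℕ → ℕ → M) {n : ℕ}
    (hn : n ≠ 0) :
    ∑ x ∈ n.divisorsAntidiagonal, c x.1 • ∑ y ∈ x.2.divisorsAntidiagonal,
      ψ y.1 • F (x.1 * y.1) y.2 = F 1 n := by
  let f : ArithmeticFunction M := ⟨fun m => if m = 0 then 0 else F (n / m) m, if_pos rfl⟩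
  have f_apply {m : ℕ} (hm : m ≠ 0) : f m = F (n / m) m := if_neg hm
  calc _ = (c • ψ • f) n := by
        simp only [ArithmeticFunction.smul_apply]
        refine Finset.sum_congr rfl fun x hx => congr_arg _ (Finset.sum_congr rfl fun y hy => ?_)
        have y_two_ne_zero := Nat.right_ne_zero_of_mem_divisorsAntidiagonal hy
        rw [f_apply y_two_ne_zero, ← (Nat.mem_divisorsAntidiagonal.1 hx).1,
          ← (Nat.mem_divisorsAntidiagonal.1 hy).1, ← mul_assoc,
          Nat.mul_div_cancel _ (Nat.pos_of_ne_zero y_two_ne_zero)]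
    _ = F 1 n := by
        rw [← mul_smul', hcψ, one_smul', f_apply hn, Nat.div_self (Nat.pos_of_ne_zero hn)]

theorem isHomogeneous_frobeniusChar {α V : Type} [Fintype α] [DecidableEq α] [AddCommGroup V]
    [Module ℂ V] (ρ : Representation ℂ (Equiv.Perm α) V) :
    (frobeniusChar ρ).IsHomogeneous (Fintype.card α) := by
  intro m
  refine not_imp_comm.1 fun hm => ?_
  rw [frobeniusChar, map_smul, map_sum, sum_eq_zero, smul_zero]
  intro σ _
  rw [map_smul, MvPowerSeries.IsHomogeneous.coeff_eq_zero (isHomogeneous_prod_p _)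
    (by rwa [σ.partition.parts_sum, Finsupp.degree_eq_weight_one]), smul_zero]

theorem isHomogeneous_cyclicIndChar (n r : ℕ) : (cyclicIndChar n r).IsHomogeneous n := by
  rcases n with _ | n
  · exact fun h => absurd rfl h
  · nth_rw 2 [← ZMod.card (n + 1)]
    exact isHomogeneous_frobeniusChar _

theorem isHomogeneous_lie (n : ℕ) : (lie n).IsHomogeneous n :=
  isHomogeneous_cyclicIndChar n 1

theorem isHomogeneous_lieTwo (n : ℕ) : (lieTwo n).IsHomogeneous n :=
  isHomogeneous_cyclicIndChar n _

theorem homogeneousComponent_sumGeTwo {q : ℕ → Series} (hq : ∀ n, (q n).IsHomogeneous n) (n : ℕ) :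
    MvPowerSeries.homogeneousComponent n (sumGeTwo q) = if 2 ≤ n then q n else 0 := by
  ext m
  rw [MvPowerSeries.coeff_homogeneousComponent]
  split_ifs with hm hn hn
  · subst hm
    exact if_pos hn
  · subst hm
    exact if_neg hn
  · exact (MvPowerSeries.IsHomogeneous.coeff_eq_zero (hq n) hm).symm
  · rfl

theorem one_le_order_sumGeTwo (q : ℕ → Series) : 1 ≤ (sumGeTwo q).order := by
  refine MvPowerSeries.le_order fun m hm => if_neg ?_
  have : m.degree < 1 := by exact_mod_cast hm
  omega

section

variable {c ψ : ArithmeticFunction ℂ} {r : ℕ → ℕ}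

theorem homogeneousComponent_euler_p_add_sumGeTwo
    (hψ : ∀ n, ∀ d ∈ n.divisors, ramanujanSum (r n) d = ψ d) (n : ℕ) :
    MvPowerSeries.homogeneousComponent n
        (euler (p 1 + sumGeTwo fun n => cyclicIndChar n (r n))) =
      ∑ x ∈ n.divisorsAntidiagonal, ψ x.1 • p x.1 ^ x.2 := by
  rw [homogeneousComponent_euler, map_add,
    homogeneousComponent_of_isHomogeneous (isHomogeneous_p 1),
    homogeneousComponent_sumGeTwo fun n => isHomogeneous_cyclicIndChar n (r n),
    Nat.sum_divisorsAntidiagonal fun d j => ψ d • p d ^ j]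
  rcases n with _ | _ | n
  · rw [zero_smul, Nat.divisors_zero, sum_empty]
  · simp [← hψ 1 1, ramanujanSum_one_right]
  · rw [if_neg (by omega), if_pos (by omega), zero_add, nsmul_cyclicIndChar]
    exact Finset.sum_congr rfl fun d hd => by rw [hψ _ d hd]

theorem sum_smul_expand_euler_sumGeTwo (hcψ : c * ψ = 1)
    (hψ : ∀ n, ∀ d ∈ n.divisors, ramanujanSum (r n) d = ψ d) (n : ℕ) :
    ∑ i ∈ range (n + 1), c (i + 1) • MvPowerSeries.homogeneousComponent (n + 1)
      (MvPowerSeries.expand (i + 1) i.succ_ne_zero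
        (euler (sumGeTwo fun n => cyclicIndChar n (r n)))) =
      p 1 ^ (n + 1) - c (n + 1) • p (n + 1) := by
  let L := sumGeTwo fun n => cyclicIndChar n (r n)
  let component (f : Series) (i : ℕ) : Series := MvPowerSeries.homogeneousComponent (n + 1)
    (MvPowerSeries.expand (i + 1) i.succ_ne_zero (euler f))
  have component_p_add (i : ℕ) : component (p 1 + L) i = if i + 1 ∣ n + 1 then
      ∑ y ∈ ((n + 1) / (i + 1)).divisorsAntidiagonal, ψ y.1 • p ((i + 1) * y.1) ^ y.2 else 0 := by
    simp only [component, L, homogeneousComponent_expand,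
      homogeneousComponent_euler_p_add_sumGeTwo hψ, map_sum, map_smul, map_pow, expand_p]
  have component_p (i : ℕ) : component (p 1) i = if n = i then p (n + 1) else 0 := by
    simp only [component, euler_of_isHomogeneous (isHomogeneous_p 1), one_smul, expand_p, mul_one,
      homogeneousComponent_of_isHomogeneous (isHomogeneous_p (i + 1)), add_left_inj]
    split_ifs with hi <;> simp [hi]
  have total : ∑ i ∈ range (n + 1), c (i + 1) • component (p 1 + L) i = p 1 ^ (n + 1) := by
    simp only [component_p_add, smul_ite, smul_zero]
    rw [sum_range_ite_dvd fun k m => c k • ∑ y ∈ m.divisorsAntidiagonal, ψ y.1 • p (k * y.1) ^ y.2]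
    exact sum_divisorsAntidiagonal_of_mul_eq_one hcψ (fun a b => p a ^ b) n.succ_ne_zero
  have part_p : ∑ i ∈ range (n + 1), c (i + 1) • component (p 1) i = c (n + 1) • p (n + 1) := by
    simp [component_p]
  rw [← total, ← part_p, ← sum_sub_distrib]
  refine Finset.sum_congr rfl fun i _ => ?_
  rw [← smul_sub]
  simp only [component, ← map_sub, add_sub_cancel_left, L]

theorem le_order_smul_expand (b : ℂ) {f : Series} (hf : 1 ≤ f.order) (i : ℕ) :
    (i + 1 : ℕ) ≤ (b • MvPowerSeries.expand (i + 1) i.succ_ne_zero f).order := by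
  refine le_trans ?_ MvPowerSeries.le_order_smul
  rw [MvPowerSeries.order_expand, nsmul_eq_mul]
  exact le_mul_of_one_le_right' hf

theorem IsExp.sumComponent_expand {b : ℕ → ℂ} {f : Series} {g : ℕ → Series}
    (hg : IsExp (fun i => b i • MvPowerSeries.expand (i + 1) i.succ_ne_zero f) g)
    (hf : 1 ≤ f.order) :
    IsExp (fun n => ∑ i ∈ range (n + 1), b i • MvPowerSeries.homogeneousComponent (n + 1)
      (MvPowerSeries.expand (i + 1) i.succ_ne_zero (euler f))) (SymFn.sumComponent g) := by
  simp only [← map_smul]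
  refine hg.sumComponent (fun i => ?_) fun i => ?_
  · rw [Derivation.map_smul, euler_expand, map_smul, smul_comm]
  · exact le_order_smul_expand _ hf i

theorem isExp_sumComponent_sumGeTwo (hcψ : c * ψ = 1)
    (hψ : ∀ n, ∀ d ∈ n.divisors, ramanujanSum (r n) d = ψ d) {a : ℂ} {g : ℕ → Series}
    (hg : IsExp (fun i => (a * c (i + 1)) • MvPowerSeries.expand (i + 1) i.succ_ne_zero
      (sumGeTwo fun n => cyclicIndChar n (r n))) g) :
    IsExp (fun n => a • (p 1 ^ (n + 1) - c (n + 1) • p (n + 1))) (sumComponent g) := by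
  simpa only [mul_smul, ← smul_sum, sum_smul_expand_euler_sumGeTwo hcψ hψ] using
    hg.sumComponent_expand (one_le_order_sumGeTwo _)

end

theorem isExp_sumComponent_plethysm_h_lie :
    IsExp (fun n => p 1 ^ (n + 1) - p (n + 1))
      (sumComponent fun k => plethysm (h k) (sumGeTwo lie)) := by
  simpa using! isExp_sumComponent_sumGeTwo zeta_mul_ramanujanSum_one (r := fun _ => 1)
    (fun _ _ _ => rfl) (a := 1) (by simpa using! isExp_plethysm_h (sumGeTwo lie))

theorem isExp_sumComponent_signed_plethysm_e_lie :
    IsExp (fun n => p (n + 1) - p 1 ^ (n + 1))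
      (sumComponent fun k => (-1) ^ k * plethysm (e k) (sumGeTwo lie)) := by
  simpa using! isExp_sumComponent_sumGeTwo zeta_mul_ramanujanSum_one (r := fun _ => 1)
    (fun _ _ _ => rfl) (a := -1)
    (by simpa [pow_succ, ← mul_assoc, ← mul_pow] using! (isExp_plethysm_e (sumGeTwo lie)).signed)

theorem isExp_sumComponent_plethysm_e_lieTwo :
    IsExp (fun n => p 1 ^ (n + 1) + (-1) ^ (n + 1) * p (n + 1))
      (sumComponent fun k => plethysm (e k) (sumGeTwo lieTwo)) := by
  simpa [altSign_succ, neg_one_pow_smul, pow_succ, sub_eq_add_neg] using!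
    isExp_sumComponent_sumGeTwo altSign_mul_ramanujanSumTwo
      (r := fun n => 2 ^ padicValNat 2 n) (fun _ _ => ramanujanSum_two_pow_padicValNat) (a := 1)
      (by simpa [altSign_succ, neg_one_pow_smul] using! isExp_plethysm_e (sumGeTwo lieTwo))

theorem isExp_sumComponent_signed_plethysm_h_lieTwo :
    IsExp (fun n => (-1) ^ n * p (n + 1) - p 1 ^ (n + 1))
      (sumComponent fun k => (-1) ^ k * plethysm (h k) (sumGeTwo lieTwo)) := by
  simpa [altSign_succ, neg_one_pow_smul] using!
    isExp_sumComponent_sumGeTwo altSign_mul_ramanujanSumTwo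
      (r := fun n => 2 ^ padicValNat 2 n) (fun _ _ => ramanujanSum_two_pow_padicValNat) (a := -1)
      (by simpa [altSign_succ, neg_one_pow_smul, pow_succ] using!
        (isExp_plethysm_h (sumGeTwo lieTwo)).signed)

theorem sumComponent_plethysm_h_lie (n : ℕ) :
    sumComponent (fun k => plethysm (h k) (sumGeTwo lie)) n =
      ∑ ij ∈ antidiagonal n, p 1 ^ ij.1 * ((-1) ^ ij.2 * e ij.2) := by
  have product := (isExp_pow (p 1)).mul isExp_e.signed
  have exponents : (fun i => p 1 ^ (i + 1)) + (fun i => (-1) ^ (i + 1) * ((-1) ^ i * p (i + 1))) =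
      fun i => p 1 ^ (i + 1) - p (i + 1) := by
    ext1 i
    simp [pow_succ, ← mul_assoc, ← mul_pow, sub_eq_add_neg]
  exact congr_fun (isExp_sumComponent_plethysm_h_lie.unique (exponents ▸ product)) n

theorem sumComponent_plethysm_e_lieTwo (n : ℕ) :
    sumComponent (fun k => plethysm (e k) (sumGeTwo lieTwo)) n =
      ∑ ij ∈ antidiagonal n, p 1 ^ ij.1 * ((-1) ^ ij.2 * h ij.2) :=
  congr_fun (isExp_sumComponent_plethysm_e_lieTwo.unique <|
    (isExp_pow (p 1)).mul isExp_h.signed) n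

theorem sumComponent_signed_plethysm_e_lie (n : ℕ) :
    sumComponent (fun k => (-1) ^ k * plethysm (e k) (sumGeTwo lie)) (n + 1) =
      h (n + 1) - p 1 * h n :=
  isExp_sumComponent_signed_plethysm_e_lie.succ_of_sub_pow isExp_h n

theorem sumComponent_signed_plethysm_h_lieTwo (n : ℕ) :
    sumComponent (fun k => (-1) ^ k * plethysm (h k) (sumGeTwo lieTwo)) (n + 1) =
      e (n + 1) - p 1 * e n :=
  isExp_sumComponent_signed_plethysm_h_lieTwo.succ_of_sub_pow isExp_e n

end CyclicSums

/-! ### The unsigned and signed sums -/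

section Omega

open MvPolynomial

/-- The algebra of symmetric functions of bounded degree, as the algebra generated by the power
sums. The function `omega` takes junk values outside of it. -/
def powerSumAlgebra : Subalgebra ℂ Series :=
  (aeval (R := ℂ) fun k : ℕ => p (k + 1)).range

theorem aeval_p_mem (P : MvPolynomial ℕ ℂ) : aeval (fun k => p (k + 1)) P ∈ powerSumAlgebra :=
  ⟨P, rfl⟩

theorem p_mem {k : ℕ} (hk : k ≠ 0) : p k ∈ powerSumAlgebra := by
  obtain ⟨k, rfl⟩ := Nat.exists_eq_succ_of_ne_zero hk
  simpa using aeval_p_mem (X k)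

theorem h_mem (n : ℕ) : h n ∈ powerSumAlgebra := aeval_newtonPoly_h n ▸ aeval_p_mem _

theorem e_mem (n : ℕ) : e n ∈ powerSumAlgebra := aeval_newtonPoly_e n ▸ aeval_p_mem _

/-- The involution `omega` as a homomorphism on the algebra of symmetric functions. -/
def omegaHom : powerSumAlgebra →ₐ[ℂ] Series :=
  (aeval fun k : ℕ => (-1 : Series) ^ k * p (k + 1)).comp
    (AlgEquiv.ofInjective _ algebraicIndependent_p).symm.toAlgHom

theorem omega_aeval (P : MvPolynomial ℕ ℂ) : omega (aeval (fun k => p (k + 1)) P) =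
    aeval (fun k : ℕ => (-1 : Series) ^ k * p (k + 1)) P := by
  rw [omega, toPowerSums_aeval]

theorem omegaHom_apply (f : powerSumAlgebra) : omegaHom f = omega f := by
  obtain ⟨P, rfl⟩ := (AlgEquiv.ofInjective _ algebraicIndependent_p).surjective f
  refine Eq.trans ?_ (omega_aeval P).symm
  exact congr_arg (aeval fun k : ℕ => (-1 : Series) ^ k * p (k + 1))
    ((AlgEquiv.ofInjective _ algebraicIndependent_p).symm_apply_apply P)

theorem omega_p_one : omega (p 1) = p 1 := by
  simpa using omega_aeval (X 0)

theorem omega_h (n : ℕ) : omega (h n) = e n := by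
  rw [← aeval_newtonPoly_h, omega_aeval]
  refine congr_fun (IsExp.unique (isExp_aeval_newtonPoly _ _) ?_) n
  simpa only [Pi.one_apply, one_smul] using isExp_e

theorem omega_e (n : ℕ) : omega (e n) = h n := by
  rw [← aeval_newtonPoly_e, omega_aeval]
  refine congr_fun (IsExp.unique (isExp_aeval_newtonPoly _ _) ?_) n
  simpa [neg_one_pow_smul, ← mul_assoc, ← mul_pow] using isExp_h

/-- The algebra of symmetric functions of unbounded degree: the series all of whose homogeneous
components are polynomials in the power sums. It contains the plethysms with infinite sums. -/
def symmetricSeries : Subalgebra ℂ Series where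
  carrier := {f | ∀ n, MvPowerSeries.homogeneousComponent n f ∈ powerSumAlgebra}
  mul_mem' hf hg n := by
    rw [homogeneousComponent_mul]
    exact sum_mem fun ij _ => mul_mem (hf ij.1) (hg ij.2)
  add_mem' hf hg n := by
    rw [map_add]
    exact add_mem (hf n) (hg n)
  algebraMap_mem' a n := by
    rw [Algebra.algebraMap_eq_smul_one, map_smul,
      homogeneousComponent_of_isHomogeneous isHomogeneous_one]
    split_ifs
    · exact Subalgebra.smul_mem _ (one_mem _) a
    · rw [smul_zero]
      exact zero_mem _

theorem expand_mem_powerSumAlgebra {k : ℕ} (hk : k ≠ 0) {f : Series} (hf : f ∈ powerSumAlgebra) :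
    MvPowerSeries.expand k hk f ∈ powerSumAlgebra := by
  have generators : Algebra.adjoin ℂ (Set.range fun k : ℕ => p (k + 1)) ≤
      powerSumAlgebra.comap (MvPowerSeries.expand k hk) := by
    refine Algebra.adjoin_le ?_
    rintro _ ⟨j, rfl⟩
    rw [SetLike.mem_coe, Subalgebra.mem_comap, expand_p]
    exact p_mem (mul_ne_zero hk j.succ_ne_zero)
  exact generators (Algebra.adjoin_range_eq_range_aeval ℂ (fun k : ℕ => p (k + 1)) ▸ hf)

theorem expand_mem_symmetricSeries {k : ℕ} (hk : k ≠ 0) {f : Series} (hf : f ∈ symmetricSeries) :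
    MvPowerSeries.expand k hk f ∈ symmetricSeries := by
  intro n
  rw [homogeneousComponent_expand]
  split_ifs
  · exact expand_mem_powerSumAlgebra hk (hf _)
  · exact zero_mem _

theorem frobeniusChar_mem {α V : Type} [Fintype α] [DecidableEq α] [AddCommGroup V] [Module ℂ V]
    (ρ : Representation ℂ (Equiv.Perm α) V) : frobeniusChar ρ ∈ powerSumAlgebra := by
  refine Subalgebra.smul_mem _ (sum_mem fun σ _ => Subalgebra.smul_mem _ ?_ _) _
  refine multiset_prod_mem _ fun f hf => ?_
  obtain ⟨k, hk, rfl⟩ := Multiset.mem_map.1 hf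
  exact p_mem (σ.partition.parts_pos hk).ne'

theorem sumGeTwo_mem_symmetricSeries {q : ℕ → Series} (hq : ∀ n, (q n).IsHomogeneous n)
    (hq' : ∀ n, q n ∈ powerSumAlgebra) : sumGeTwo q ∈ symmetricSeries := by
  intro n
  rw [homogeneousComponent_sumGeTwo hq]
  split_ifs
  · exact hq' n
  · exact zero_mem _

theorem lie_mem (n : ℕ) : lie n ∈ powerSumAlgebra := by
  rcases n with _ | n
  · exact zero_mem _
  · exact frobeniusChar_mem _

theorem sumGeTwo_lie_mem : sumGeTwo lie ∈ symmetricSeries :=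
  sumGeTwo_mem_symmetricSeries isHomogeneous_lie lie_mem

theorem deg_plethysm_mem (n : ℕ) (f : Series) {g : Series} (hg : g ∈ symmetricSeries) :
    deg n (plethysm f g) ∈ powerSumAlgebra := by
  refine (?_ : plethysm f g ∈ symmetricSeries) n
  rw [plethysm, aeval_def, eval₂_eq]
  exact sum_mem fun d _ => mul_mem (algebraMap_mem _ _)
    (prod_mem fun i _ => pow_mem (expand_mem_symmetricSeries _ hg) _)

end Omega

section Totals

theorem finsum_one_le_eq_sum_range {M : Type*} [AddCommMonoid M] {f : ℕ → M} {n : ℕ}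
    (h0 : f 0 = 0) (hn : ∀ r, n < r → f r = 0) :
    ∑ᶠ (r : ℕ) (_ : 1 ≤ r), f r = ∑ r ∈ range (n + 1), f r := by
  refine finsum_mem_eq_sum_of_inter_support_eq (s := {r | 1 ≤ r}) f (Set.ext fun r => ?_)
  simp only [Set.mem_inter_iff, Set.mem_ofPred_eq, Function.mem_support, mem_coe, mem_range,
    and_congr_left_iff]
  intro hr
  have pos : r ≠ 0 := fun h => hr (h ▸ h0)
  have le : ¬n < r := fun h => hr (hn r h)
  omega

theorem finsum_one_le_neg_one_pow_sub_one_mul {R : Type*} [Ring R] (f : ℕ → R) :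
    ∑ᶠ (r : ℕ) (_ : 1 ≤ r), (-1) ^ (r - 1) * f r =
      -∑ᶠ (r : ℕ) (_ : 1 ≤ r), (-1) ^ r * f r := by
  rw [← finsum_neg_distrib]
  refine finsum_congr fun r => ?_
  rw [← finsum_neg_distrib]
  refine finsum_congr fun hr => ?_
  obtain ⟨r, rfl⟩ := Nat.exists_eq_add_of_le' hr
  simp [pow_succ]

theorem omega_zero : omega 0 = 0 :=
  (omegaHom_apply 0).symm.trans (map_zero _)

theorem omega_mul {f g : Series} (hf : f ∈ powerSumAlgebra) (hg : g ∈ powerSumAlgebra) :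
    omega (f * g) = omega f * omega g := by
  simpa only [omegaHom_apply] using! map_mul omegaHom ⟨f, hf⟩ ⟨g, hg⟩

theorem omega_sub {f g : Series} (hf : f ∈ powerSumAlgebra) (hg : g ∈ powerSumAlgebra) :
    omega (f - g) = omega f - omega g := by
  simpa only [omegaHom_apply] using! map_sub omegaHom ⟨f, hf⟩ ⟨g, hg⟩

theorem omega_sum {ι : Type*} (s : Finset ι) {f : ι → Series}
    (hf : ∀ i, f i ∈ powerSumAlgebra) : omega (∑ i ∈ s, f i) = ∑ i ∈ s, omega (f i) := by
  simpa only [omegaHom_apply, AddSubmonoidClass.coe_finsetSum] using!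
    map_sum omegaHom (fun i => ⟨f i, hf i⟩) s

theorem omega_neg_one_pow_mul (k : ℕ) {f : Series} (hf : f ∈ powerSumAlgebra) :
    omega ((-1) ^ k * f) = (-1) ^ k * omega f := by
  rw [← neg_one_pow_smul, ← neg_one_pow_smul]
  simpa only [omegaHom_apply] using! map_smul omegaHom ((-1) ^ k : ℂ) ⟨f, hf⟩

theorem omega_p_one_pow (n : ℕ) : omega (p 1 ^ n) = p 1 ^ n := by
  rw [← omega_p_one]
  simpa only [omegaHom_apply, omega_p_one] using! map_pow omegaHom ⟨p 1, p_mem one_ne_zero⟩ n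

theorem deg_neg_one_pow_mul (n k : ℕ) (f : Series) :
    deg n ((-1) ^ k * f) = (-1) ^ k * deg n f := by
  rw [← neg_one_pow_smul, ← neg_one_pow_smul]
  exact map_smul _ _ f

variable {F : ℕ → Series} {n : ℕ}

theorem deg_eq_zero_of_le_order (h0 : F 0 = 1) (hF : ∀ k : ℕ, k ≤ (F k).order) (hn : n ≠ 0) :
    deg n (F 0) = 0 ∧ ∀ r, n < r → deg n (F r) = 0 :=
  ⟨h0 ▸ (homogeneousComponent_of_isHomogeneous isHomogeneous_one n).trans (if_neg hn),
    fun r hr => homogeneousComponent_eq_zero_of_lt (hF r) hr⟩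

theorem finsum_deg (h0 : F 0 = 1) (hF : ∀ k : ℕ, k ≤ (F k).order) (hn : n ≠ 0) :
    ∑ᶠ (r : ℕ) (_ : 1 ≤ r), deg n (F r) = sumComponent F n :=
  have vanish := deg_eq_zero_of_le_order h0 hF hn
  finsum_one_le_eq_sum_range vanish.1 vanish.2

theorem finsum_omega_deg (h0 : F 0 = 1) (hF : ∀ k : ℕ, k ≤ (F k).order) (hn : n ≠ 0)
    (hmem : ∀ k, deg n (F k) ∈ powerSumAlgebra) :
    ∑ᶠ (r : ℕ) (_ : 1 ≤ r), omega (deg n (F r)) = omega (sumComponent F n) := by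
  have vanish := deg_eq_zero_of_le_order h0 hF hn
  rw [finsum_one_le_eq_sum_range (f := fun r => omega (deg n (F r))) (n := n)
    (by rw [vanish.1, omega_zero]) fun r hr => by rw [vanish.2 r hr, omega_zero]]
  exact (omega_sum _ hmem).symm

theorem le_order_plethysm_h {f : Series} (hf : 1 ≤ f.order) (k : ℕ) :
    k ≤ (plethysm (h k) f).order :=
  (isExp_plethysm_h f).le_order (fun i => by simpa using le_order_smul_expand 1 hf i) k

theorem le_order_plethysm_e {f : Series} (hf : 1 ≤ f.order) (k : ℕ) :
    k ≤ (plethysm (e k) f).order :=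
  (isExp_plethysm_e f).le_order
    (fun i => by simpa only [neg_one_pow_smul] using le_order_smul_expand ((-1) ^ i) hf i) k

theorem le_order_neg_one_pow_mul {k d : ℕ} {f : Series} (hf : d ≤ f.order) :
    d ≤ ((-1) ^ k * f).order := by
  rw [← neg_one_pow_smul]
  exact hf.trans MvPowerSeries.le_order_smul

theorem sum_antidiagonal_p_one_pow_mul (f : ℕ → Series) (n : ℕ) :
    ∑ ij ∈ antidiagonal n, p 1 ^ ij.1 * ((-1) ^ ij.2 * f ij.2) =
      ∑ k ∈ range (n + 1), (-1) ^ k * p 1 ^ (n - k) * f k := by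
  rw [← Nat.sum_antidiagonal_swap, Nat.sum_antidiagonal_eq_sum_range_succ_mk]
  exact Finset.sum_congr rfl fun k _ => by simp only [Prod.swap_prod_mk]; ring

theorem finsum_deltaPiece (hn : n ≠ 0) : ∑ᶠ (r : ℕ) (_ : 1 ≤ r), deltaPiece n r =
    ∑ k ∈ range (n + 1), (-1) ^ k * p 1 ^ (n - k) * h k := by
  rw [← sum_antidiagonal_p_one_pow_mul, ← sumComponent_plethysm_e_lieTwo]
  exact finsum_deg (isExp_plethysm_e _).zero (le_order_plethysm_e (one_le_order_sumGeTwo _)) hn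

theorem finsum_omega_hodgePiece (hn : n ≠ 0) : ∑ᶠ (r : ℕ) (_ : 1 ≤ r), omega (hodgePiece n r) =
    ∑ k ∈ range (n + 1), (-1) ^ k * p 1 ^ (n - k) * h k := by
  have mem (ij : ℕ × ℕ) : p 1 ^ ij.1 * ((-1) ^ ij.2 * e ij.2) ∈ powerSumAlgebra :=
    mul_mem (pow_mem (p_mem one_ne_zero) _) (mul_mem (pow_mem (neg_mem (one_mem _)) _) (e_mem _))
  calc ∑ᶠ (r : ℕ) (_ : 1 ≤ r), omega (hodgePiece n r)
    _ = omega (sumComponent (fun k => plethysm (h k) (sumGeTwo lie)) n) :=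
      finsum_omega_deg (isExp_plethysm_h _).zero (le_order_plethysm_h (one_le_order_sumGeTwo _)) hn
        fun k => deg_plethysm_mem n _ sumGeTwo_lie_mem
    _ = ∑ ij ∈ antidiagonal n, p 1 ^ ij.1 * ((-1) ^ ij.2 * h ij.2) := by
      rw [sumComponent_plethysm_h_lie, omega_sum _ mem]
      refine Finset.sum_congr rfl fun ij _ => ?_
      rw [omega_mul (pow_mem (p_mem one_ne_zero) _)
        (mul_mem (pow_mem (neg_mem (one_mem _)) _) (e_mem _)), omega_p_one_pow,
        omega_neg_one_pow_mul _ (e_mem _), omega_e]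
    _ = _ := sum_antidiagonal_p_one_pow_mul h n

theorem finsum_signed_deg_plethysm_h_lieTwo (n : ℕ) :
    ∑ᶠ (r : ℕ) (_ : 1 ≤ r), (-1) ^ (r - 1) * deg (n + 1) (plethysm (h r) (sumGeTwo lieTwo)) =
      p 1 * e n - e (n + 1) := by
  have total := finsum_deg (F := fun k => (-1) ^ k * plethysm (h k) (sumGeTwo lieTwo))
    (isExp_plethysm_h _).signed.zero
    (fun k => le_order_neg_one_pow_mul (le_order_plethysm_h (one_le_order_sumGeTwo _) k))
    (n := n + 1) n.succ_ne_zero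
  rw [sumComponent_signed_plethysm_h_lieTwo] at total
  rw [finsum_one_le_neg_one_pow_sub_one_mul, ← neg_sub (e (n + 1)), ← total]
  simp only [deg_neg_one_pow_mul]

theorem finsum_signed_omega_deg_plethysm_e_lie (n : ℕ) :
    ∑ᶠ (r : ℕ) (_ : 1 ≤ r), (-1) ^ (r - 1) * omega (deg (n + 1) (plethysm (e r) (sumGeTwo lie))) =
      p 1 * e n - e (n + 1) := by
  have mem (k : ℕ) := deg_plethysm_mem (n + 1) (e k) sumGeTwo_lie_mem
  have total := finsum_omega_deg (F := fun k => (-1) ^ k * plethysm (e k) (sumGeTwo lie))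
    (isExp_plethysm_e _).signed.zero
    (fun k => le_order_neg_one_pow_mul (le_order_plethysm_e (one_le_order_sumGeTwo _) k))
    (n := n + 1) n.succ_ne_zero fun k => by
      rw [deg_neg_one_pow_mul]
      exact mul_mem (pow_mem (neg_mem (one_mem _)) _) (mem k)
  have p_one_mem := p_mem one_ne_zero
  rw [sumComponent_signed_plethysm_e_lie, omega_sub (h_mem _) (mul_mem p_one_mem (h_mem _)),
    omega_mul p_one_mem (h_mem _), omega_h, omega_h, omega_p_one] at total
  rw [finsum_one_le_neg_one_pow_sub_one_mul, ← neg_sub (e (n + 1)), ← total]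
  simp only [deg_neg_one_pow_mul, omega_neg_one_pow_mul _ (mem _)]

theorem h_one : h 1 = p 1 := by
  simpa [isExp_h.zero] using isExp_h.succ 0

theorem delta_eq_sum : ∀ n : ℕ, delta n = ∑ k ∈ range (n + 1), (-1) ^ k * p 1 ^ (n - k) * h k
  | 0 => by simp [delta, isExp_h.zero]
  | 1 => by simp [sum_range_succ, delta, isExp_h.zero, h_one]
  | n + 2 => finsum_deltaPiece (n + 1).succ_ne_zero

theorem delta_succ (n : ℕ) : delta (n + 1) = p 1 * delta n + (-1) ^ (n + 1) * h (n + 1) := by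
  rw [delta_eq_sum, delta_eq_sum, sum_range_succ, Finset.mul_sum, Nat.sub_self, pow_zero, mul_one]
  congr 1
  refine Finset.sum_congr rfl fun k hk => ?_
  rw [Nat.succ_sub (Nat.lt_succ_iff.1 (mem_range.1 hk)), pow_succ]
  ring

end Totals

/-! ### The Schur function of the hook `(2, 1 ^ (n - 2))` -/

section Hook

open Finsupp (toMultiset)

theorem mem_hookTwo {k i j : ℕ} :
    (i, j) ∈ hookTwo (k + 2) ↔ i = 0 ∧ j = 1 ∨ i < k + 1 ∧ j = 0 := by
  rw [hookTwo, YoungDiagram.mem_ofRowLens]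
  rcases i with _ | i
  · simp
    omega
  · simp

theorem val_cells_hookTwo (k : ℕ) :
    (hookTwo (k + 2)).cells.val = (0, 1) ::ₘ (Multiset.range (k + 1)).map fun i => (i, 0) := by
  refine (Multiset.Nodup.ext (Finset.nodup _) ?_).2 fun ⟨i, j⟩ => ?_
  · refine Multiset.nodup_cons.2 ⟨by simp, (Multiset.nodup_range _).map fun i j hij => ?_⟩
    exact (Prod.ext_iff.1 hij).1
  · rw [Finset.mem_val, YoungDiagram.mem_cells, mem_hookTwo]
    simp [eq_comm (a := 0) (b := j)]
    omega

theorem card_filter_cells_hookTwo_eq_iff {k : ℕ} {m : ℕ →₀ ℕ} (f : ℕ → ℕ → ℕ) :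
    (∀ i, #{c ∈ (hookTwo (k + 2)).cells | f c.1 c.2 = i} = m i) ↔
      f 0 1 ::ₘ (Multiset.range (k + 1)).map (fun i => f i 0) = toMultiset m := by
  have count (i : ℕ) : #{c ∈ (hookTwo (k + 2)).cells | f c.1 c.2 = i} =
      (f 0 1 ::ₘ (Multiset.range (k + 1)).map fun i => f i 0).count i := by
    rw [card_def, filter_val, val_cells_hookTwo]
    simp only [eq_comm (b := i)]
    rw [← Multiset.count_map (fun c : ℕ × ℕ => f c.1 c.2)]
    simp
  simp only [Multiset.ext, Finsupp.count_toMultiset, count]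

theorem coeff_e_eq_ite_nodup (n : ℕ) (m : ℕ →₀ ℕ) : MvPowerSeries.coeff m (e n) =
    if (toMultiset m).card = n ∧ (toMultiset m).Nodup then 1 else 0 := by
  have nodup : (toMultiset m).Nodup ↔ ∀ i, m i ≤ 1 := by
    simp only [Multiset.nodup_iff_count_le_one, Finsupp.count_toMultiset]
  rw [coeff_e]
  congr 1
  rw [nodup, Finsupp.card_toMultiset]
  rfl

/-- The letters that can be removed from a multiset to leave a set of `n` letters. In a tableau of
shape `(2, 1 ^ (n - 1))` with content `M`, the set is the first column and the removed letter is the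
entry outside of it. -/
def hookLetters (n : ℕ) (M : Multiset ℕ) : Finset ℕ :=
  {s ∈ M.toFinset | (M.erase s).card = n ∧ (M.erase s).Nodup}

theorem mem_hookLetters {n s : ℕ} {M : Multiset ℕ} :
    s ∈ hookLetters n M ↔ s ∈ M ∧ (M.erase s).card = n ∧ (M.erase s).Nodup := by
  rw [hookLetters, mem_filter, Multiset.mem_toFinset]

theorem toMultiset_tsub_single (m : ℕ →₀ ℕ) (i : ℕ) :
    toMultiset (m - Finsupp.single i 1) = (toMultiset m).erase i := by
  ext j
  rw [Finsupp.count_toMultiset, Finsupp.tsub_apply, Finsupp.single_apply]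
  split_ifs with hij
  · rw [hij, Multiset.count_erase_self, Finsupp.count_toMultiset]
  · rw [Multiset.count_erase_of_ne (Ne.symm hij), Finsupp.count_toMultiset, tsub_zero]

theorem coeff_p_one_mul_e (n : ℕ) (m : ℕ →₀ ℕ) :
    MvPowerSeries.coeff m (p 1 * e n) = #(hookLetters n (toMultiset m)) := by
  have support : {i ∈ m.support | 1 ≤ m i} = m.support :=
    filter_true_of_mem fun i hi => Nat.one_le_iff_ne_zero.2 (Finsupp.mem_support_iff.1 hi)
  simp only [coeff_p_mul one_ne_zero, coeff_e_eq_ite_nodup, toMultiset_tsub_single, support]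
  rw [sum_boole, hookLetters, Finsupp.toFinset_toMultiset]

theorem card_filter_hookLetters_lt (n : ℕ) (M : Multiset ℕ) :
    #{s ∈ hookLetters n M | ∀ t ∈ M.erase s, s < t} =
      if M.card = n + 1 ∧ M.Nodup then 1 else 0 := by
  split_ifs with h
  · have nonempty : M.toFinset.Nonempty := by
      rw [Multiset.toFinset_nonempty, ← Multiset.card_pos, h.1]
      exact n.succ_pos
    refine card_eq_one.2 ⟨M.toFinset.min' nonempty, Finset.ext fun s => ?_⟩
    have below : (∀ t ∈ M.erase s, s < t) ↔ ∀ t ∈ M.toFinset, s ≤ t := by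
      simp only [h.2.mem_erase_iff, Multiset.mem_toFinset, and_imp]
      grind
    have erase (hs : s ∈ M) : (M.erase s).card = n ∧ (M.erase s).Nodup :=
      ⟨by rw [Multiset.card_erase_of_mem hs, h.1, Nat.pred_succ], h.2.erase s⟩
    rw [mem_filter, mem_hookLetters, mem_singleton, below, eq_comm (a := s), min'_eq_iff,
      Multiset.mem_toFinset]
    tauto
  · refine card_eq_zero.2 (filter_eq_empty_iff.2 fun s hs lt => h ?_)
    obtain ⟨mem, card, nodup⟩ := mem_hookLetters.1 hs
    rw [← Multiset.cons_erase mem]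
    exact ⟨by rw [Multiset.card_cons, card],
      Multiset.nodup_cons.2 ⟨fun hs => lt_irrefl s (lt s hs), nodup⟩⟩

theorem column_pairwise_lt {k : ℕ} (T : SemistandardYoungTableau (hookTwo (k + 2))) :
    ((List.range (k + 1)).map fun i => T i 0).Pairwise (· < ·) := by
  rw [List.pairwise_map]
  refine List.pairwise_lt_range.imp_of_mem fun _ hj hij => ?_
  exact T.col_strict hij (mem_hookTwo.2 (Or.inr ⟨List.mem_range.1 hj, rfl⟩))

/-- The tableau of shape `(2, 1 ^ k)` with first column `l` and remaining entry `s`. -/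
def hookTableau {k s : ℕ} {l : List ℕ} (hl : l.Pairwise (· < ·)) (hlk : l.length = k + 1)
    (hs : ∃ t ∈ l, t ≤ s) : SemistandardYoungTableau (hookTwo (k + 2)) where
  entry i j := if j = 0 then l.getD i 0 else if i = 0 ∧ j = 1 then s else 0
  row_weak' {i j₁ j₂} hj hmem := by
    obtain ⟨t, ht, hts⟩ := hs
    obtain ⟨rfl, rfl⟩ | ⟨-, rfl⟩ := mem_hookTwo.1 hmem
    · obtain rfl : j₁ = 0 := by omega
      obtain ⟨a, l, rfl⟩ := List.exists_cons_of_length_eq_add_one hlk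
      have hat : a ≤ t := (List.mem_cons.1 ht).elim Eq.ge fun ht =>
        (List.rel_of_pairwise_cons hl ht).le
      simpa using hat.trans hts
    · omega
  col_strict' {i₁ i₂ j} hi hmem := by
    obtain ⟨rfl, -⟩ | ⟨hi₂, rfl⟩ := mem_hookTwo.1 hmem
    · omega
    · rw [if_pos rfl, if_pos rfl, List.getD_eq_getElem, List.getD_eq_getElem]
      exact List.pairwise_iff_getElem.1 hl _ _ (by omega) (by omega) hi
  zeros' {i j} hmem := by
    rw [mem_hookTwo, not_or] at hmem
    split_ifs with hj h01
    · exact List.getD_eq_default _ _ (by omega)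
    · exact absurd h01 hmem.1
    · rfl

section Content

variable {k : ℕ} {M : Multiset ℕ}

theorem exists_column_le (T : SemistandardYoungTableau (hookTwo (k + 2))) :
    ∃ t ∈ (Multiset.range (k + 1)).map (T · 0), t ≤ T 0 1 :=
  ⟨T 0 0, Multiset.mem_map_of_mem _ (Multiset.mem_range.2 k.succ_pos),
    T.row_weak one_pos (mem_hookTwo.2 (Or.inl ⟨rfl, rfl⟩))⟩

theorem eq_of_column_eq {T T' : SemistandardYoungTableau (hookTwo (k + 2))}
    (h : T 0 1 = T' 0 1)
    (hcol : (Multiset.range (k + 1)).map (T · 0) = (Multiset.range (k + 1)).map (T' · 0)) :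
    T = T' := by
  have column : ∀ i < k + 1, T i 0 = T' i 0 := by
    have lists := (Multiset.coe_eq_coe.1 hcol).eq_of_pairwise
      (fun _ _ _ _ hab hba => (lt_asymm hab hba).elim)
      (column_pairwise_lt T) (column_pairwise_lt T')
    simpa using List.map_inj_left.1 lists
  ext i j
  by_cases hij : (i, j) ∈ hookTwo (k + 2)
  · obtain ⟨rfl, rfl⟩ | ⟨hi, rfl⟩ := mem_hookTwo.1 hij
    · exact h
    · exact column i hi
  · rw [T.zeros hij, T'.zeros hij]

theorem card_tableaux_hookTwo :
    Nat.card {T : SemistandardYoungTableau (hookTwo (k + 2)) //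
      T 0 1 ::ₘ (Multiset.range (k + 1)).map (T · 0) = M} =
      #{s ∈ hookLetters (k + 1) M | ¬∀ t ∈ M.erase s, s < t} := by
  have column {T : SemistandardYoungTableau (hookTwo (k + 2))}
      (hT : T 0 1 ::ₘ (Multiset.range (k + 1)).map (T · 0) = M) :
      M.erase (T 0 1) = (Multiset.range (k + 1)).map (T · 0) := by
    rw [← hT, Multiset.erase_cons_head]
  rw [← Nat.card_eq_finsetCard]
  refine Nat.card_congr (Equiv.ofBijective (fun T => ⟨T.1 0 1, ?_⟩) ⟨fun T T' h => ?_, ?_⟩)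
  · rw [mem_filter, mem_hookLetters, column T.2]
    refine ⟨⟨?_, by simp, (column_pairwise_lt T.1).imp ne_of_lt⟩, ?_⟩
    · have mem := Multiset.mem_cons_self (T.1 0 1) ((Multiset.range (k + 1)).map (T.1 · 0))
      rwa [T.2] at mem
    · push Not
      exact exists_column_le T.1
  · have entry : T.1 0 1 = T'.1 0 1 := congr_arg Subtype.val h
    exact Subtype.ext (eq_of_column_eq entry (by rw [← column T.2, ← column T'.2, entry]))
  · rintro ⟨s, hs⟩
    rw [mem_filter, mem_hookLetters] at hs
    push Not at hs
    obtain ⟨⟨mem, card, nodup⟩, below⟩ := hs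
    let l := (M.erase s).sort
    have hlM : (l : Multiset ℕ) = M.erase s := Multiset.sort_eq _ _
    have hl : l.Pairwise (· < ·) :=
      ((Multiset.pairwise_sort _ _).sortedLE.sortedLT_of_nodup
        (by rwa [← Multiset.coe_nodup, Multiset.sort_eq])).pairwise
    have hlk : l.length = k + 1 := by rw [← Multiset.coe_card, hlM, card]
    refine ⟨⟨hookTableau (s := s) hl hlk (by simpa [l] using below), ?_⟩, rfl⟩
    have column : (Multiset.range (k + 1)).map (l.getD · 0) = l := by
      rw [← hlk, Multiset.range, Multiset.map_coe]
      exact congr_arg _ (List.ext_getElem (by simp) fun i _ hi => by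
        rw [List.getElem_map, List.getElem_range, List.getD_eq_getElem _ _ hi])
    change s ::ₘ (Multiset.range (k + 1)).map (l.getD · 0) = M
    rw [column, hlM, Multiset.cons_erase mem]

end Content

theorem schur_hookTwo (k : ℕ) : schur (hookTwo (k + 2)) = p 1 * e (k + 1) - e (k + 2) := by
  ext m
  have split := card_filter_add_card_filter_not (s := hookLetters (k + 1) (toMultiset m))
    fun s => ∀ t ∈ (toMultiset m).erase s, s < t
  rw [map_sub, coeff_p_one_mul_e, coeff_e_eq_ite_nodup, ← split, card_filter_hookLetters_lt,
    ← card_tableaux_hookTwo, Nat.cast_add, Nat.cast_ite, Nat.cast_one, Nat.cast_zero,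
    add_sub_cancel_left]
  simp only [← card_filter_cells_hookTwo_eq_iff]
  rfl

end Hook

/-! ### The Frobenius characteristic of the trivial representation -/

section Cycles

/-- The cycles of a permutation `σ`, including one for each fixed point. -/
abbrev Cycles {α : Type*} (σ : Equiv.Perm α) : Type _ := Quotient (Equiv.Perm.SameCycle.setoid σ)

variable {α : Type*} {σ : Equiv.Perm α}

theorem mk_eq_cycle_iff {q : Cycles σ} {x : α} :
    (Quotient.mk _ x : Cycles σ) = q ↔ σ.SameCycle q.out x := by
  rw [eq_comm]
  exact Quotient.eq_mk_iff_out

theorem sameCycle_out_mk (σ : Equiv.Perm α) (x : α) :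
    σ.SameCycle (Quotient.mk _ x : Cycles σ).out x :=
  mk_eq_cycle_iff.1 rfl

variable [Fintype α]

open Classical in
instance : Fintype (Cycles σ) := Fintype.ofFinite _

open Classical in
/-- The number of points on a cycle. -/
def cycleLength (q : Cycles σ) : ℕ :=
  #{x | (Quotient.mk _ x : Cycles σ) = q}

theorem cycleLength_ne_zero (q : Cycles σ) : cycleLength q ≠ 0 := by
  classical
  exact card_ne_zero.2 ⟨q.out, by simp⟩

variable [DecidableEq α]

theorem cycleLength_of_mem_support {q : Cycles σ} (hq : q.out ∈ σ.support) :
    cycleLength q = #(σ.cycleOf q.out).support := by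
  classical
  refine congr_arg card (Finset.ext fun x => ?_)
  rw [mem_filter_univ, Equiv.Perm.mem_support_cycleOf_iff, mk_eq_cycle_iff, and_iff_left hq]

theorem cycleLength_of_notMem_support {q : Cycles σ} (hq : q.out ∉ σ.support) :
    cycleLength q = 1 := by
  classical
  refine card_eq_one.2 ⟨q.out, Finset.ext fun x => ?_⟩
  rw [mem_filter_univ, mem_singleton, mk_eq_cycle_iff, eq_comm]
  exact ⟨fun hx => hx.eq_of_left (Equiv.Perm.notMem_support.1 hq), fun hx => hx ▸ .refl _ _⟩

theorem map_cycleLength_filter_mem_support (σ : Equiv.Perm α) :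
    ({q | q.out ∈ σ.support} : Finset (Cycles σ)).val.map cycleLength = σ.cycleType := by
  rw [Equiv.Perm.cycleType_def]
  refine Multiset.map_eq_map_of_bij_of_nodup _ _ (Finset.nodup _) (Finset.nodup _)
    (fun q _ => σ.cycleOf q.out) ?_ ?_ ?_ ?_
  · intro q hq
    exact Equiv.Perm.cycleOf_mem_cycleFactorsFinset_iff.2 ((mem_filter_univ q).1 hq)
  · intro q _ q' hq' hqq'
    have mem : q'.out ∈ (σ.cycleOf q.out).support := by
      rw [hqq', Equiv.Perm.mem_support_cycleOf_iff]
      exact ⟨.refl _ _, (mem_filter_univ q').1 hq'⟩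
    rw [← mk_eq_cycle_iff.2 (Equiv.Perm.mem_support_cycleOf_iff.1 mem).1, Quotient.out_eq]
  · intro c hc
    obtain ⟨x, hx⟩ := (Equiv.Perm.mem_cycleFactorsFinset_iff.1 hc).1.nonempty_support
    have hxσ : x ∈ σ.support := Equiv.Perm.mem_cycleFactorsFinset_support_le hc hx
    refine ⟨Quotient.mk _ x, ?_, ?_⟩
    · exact (mem_filter_univ _).2 ((sameCycle_out_mk σ x).mem_support_iff.2 hxσ)
    · rw [(sameCycle_out_mk σ x).cycleOf_eq, ← Equiv.Perm.cycle_is_cycleOf hx hc]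
  · intro q hq
    exact cycleLength_of_mem_support ((mem_filter_univ q).1 hq)

theorem map_cycleLength_filter_notMem_support (σ : Equiv.Perm α) :
    ({q | q.out ∉ σ.support} : Finset (Cycles σ)).val.map cycleLength =
      Multiset.replicate (Fintype.card α - #σ.support) 1 := by
  refine Multiset.eq_replicate.2 ⟨?_, ?_⟩
  · rw [Multiset.card_map, card_val, ← card_compl]
    refine card_nbij Quotient.out ?_ Quotient.out_injective.injOn fun x hx => ?_
    · simp [Set.MapsTo]
    · have fixed : σ x = x := by simpa using hx
      have out : (Quotient.mk _ x : Cycles σ).out = x :=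
        ((sameCycle_out_mk σ x).symm.eq_of_left fixed).symm
      exact ⟨Quotient.mk _ x, by simpa [out] using fixed, out⟩
  · intro l hl
    obtain ⟨q, hq, rfl⟩ := Multiset.mem_map.1 hl
    exact cycleLength_of_notMem_support ((mem_filter_univ q).1 hq)

theorem map_cycleLength (σ : Equiv.Perm α) :
    (univ : Finset (Cycles σ)).val.map cycleLength = σ.partition.parts := by
  rw [Equiv.Perm.parts_partition, ← map_cycleLength_filter_mem_support,
    ← map_cycleLength_filter_notMem_support, ← Multiset.map_add, filter_val, filter_val,
    Multiset.filter_add_not]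

theorem cyclePowerSum_eq_prod_cycleLength (σ : Equiv.Perm α) :
    cyclePowerSum σ = ∏ q : Cycles σ, p (cycleLength q) := by
  rw [cyclePowerSum, ← map_cycleLength, Multiset.map_map]
  rfl

end Cycles

section Coloring

variable {ι : Type*} [Fintype ι]

/-- The exponent of the monomial `∏ i, x_{f i} ^ k i`: the content of the coloring `f` of a set
whose elements have multiplicities `k`. -/
def content (k : ι → ℕ) (f : ι → ℕ) : ℕ →₀ ℕ :=
  ∑ i, Finsupp.single (f i) (k i)

theorem coeff_prod_p {k : ι → ℕ} (hk : ∀ i, k i ≠ 0) (m : ℕ →₀ ℕ) :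
    MvPowerSeries.coeff m (∏ i, p (k i)) = (Nat.card {g : ι → ℕ // content k g = m} : ℂ) := by
  classical
  have coeff_factor (i : ι) (l : ℕ →₀ ℕ) : MvPowerSeries.coeff l (p (k i)) =
      if ∃ t, l = Finsupp.single t (k i) then 1 else 0 := by
    rw [coeff_p]
  simp only [MvPowerSeries.coeff_prod, coeff_factor, prod_boole, mem_univ, forall_const]
  rw [sum_boole, ← Nat.card_eq_finsetCard]
  refine congr_arg _ (Eq.symm ?_)
  refine Nat.card_congr (Equiv.ofBijective (fun g =>
    ⟨Finsupp.equivFunOnFinite.symm fun i => Finsupp.single (g.1 i) (k i), ?_⟩) ⟨?_, ?_⟩)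
  · rw [mem_filter, mem_finsuppAntidiag]
    exact ⟨⟨g.2, subset_univ _⟩, fun i => ⟨g.1 i, rfl⟩⟩
  · intro g g' hgg'
    refine Subtype.ext (funext fun i => (Finsupp.single_left_inj (hk i)).1 ?_)
    exact DFunLike.congr_fun (congr_arg Subtype.val hgg') i
  · rintro ⟨l, hl⟩
    rw [mem_filter, mem_finsuppAntidiag] at hl
    obtain ⟨⟨sum_eq, -⟩, monomial⟩ := hl
    choose g hg using monomial
    refine ⟨⟨g, ?_⟩, Subtype.ext (Finsupp.ext fun i => (hg i).symm)⟩
    rw [← sum_eq, content]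
    exact Finset.sum_congr rfl fun i _ => (hg i).symm

variable {α : Type*}

/-- The colorings of `α` that are invariant under `σ`, as the colorings of the cycles of `σ`. -/
def coloringEquiv (σ : Equiv.Perm α) : (Cycles σ → ℕ) ≃ {f : α → ℕ // f ∘ σ = f} where
  toFun g := ⟨fun x => g (Quotient.mk _ x), funext fun x =>
    congr_arg g (Quotient.sound (Equiv.Perm.sameCycle_apply_left.2 (.refl σ x)))⟩
  invFun f := Quotient.lift f.1 fun x y hxy => by
    obtain ⟨k, rfl⟩ := hxy
    have stabilizes : DomMulAct.mk σ ∈ MulAction.stabilizer (Equiv.Perm α)ᵈᵐᵃ f.1 := f.2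
    exact (congr_fun (zpow_mem stabilizes k) x).symm
  left_inv g := funext fun q => Quotient.inductionOn q fun _ => rfl
  right_inv _ := rfl

variable [Fintype α]

theorem content_cycleLength (σ : Equiv.Perm α) (g : Cycles σ → ℕ) :
    content cycleLength g = content 1 (coloringEquiv σ g).1 := by
  classical
  rw [content, content, ← Finset.sum_fiberwise univ fun x => (Quotient.mk _ x : Cycles σ)]
  refine Finset.sum_congr rfl fun q _ => ?_
  rw [Finset.sum_congr rfl (g := fun _ => Finsupp.single (g q) 1), sum_const, Finsupp.smul_single,
    cycleLength, nsmul_one, Nat.cast_id]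
  intro x hx
  rw [← (mem_filter.1 hx).2]
  rfl

theorem coeff_cyclePowerSum [DecidableEq α] (σ : Equiv.Perm α) (m : ℕ →₀ ℕ) :
    MvPowerSeries.coeff m (cyclePowerSum σ) =
      (Nat.card {f : α → ℕ // content 1 f = m ∧ f ∘ σ = f} : ℂ) := by
  rw [cyclePowerSum_eq_prod_cycleLength, coeff_prod_p cycleLength_ne_zero]
  refine congr_arg _ (Nat.card_congr ?_)
  refine ((coloringEquiv σ).subtypeEquiv fun g => ?_).trans
    ((Equiv.subtypeSubtypeEquivSubtypeInter _ fun f => content 1 f = m).trans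
      (Equiv.subtypeEquivRight fun f => and_comm))
  rw [content_cycleLength]

theorem content_one (f : α → ℕ) : content 1 f = Multiset.toFinsupp (univ.val.map f) := by
  rw [content, ← Multiset.sum_map_singleton (univ.val.map f), map_multiset_sum,
    Multiset.map_map, Multiset.map_map]
  exact Finset.sum_congr rfl fun i _ => (Multiset.toFinsupp_singleton _).symm

theorem degree_content_one (f : α → ℕ) : (content 1 f).degree = Fintype.card α := by
  rw [content, map_sum]
  simp

theorem exists_content_one_eq {m : ℕ →₀ ℕ} (hm : m.degree = Fintype.card α) :
    ∃ f : α → ℕ, content 1 f = m := by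
  let M := Finsupp.toMultiset m
  have card : Fintype.card α = Fintype.card M := by
    rw [Multiset.card_coe, Finsupp.card_toMultiset, ← hm]
    rfl
  let e := Fintype.equivOfCardEq card
  refine ⟨fun x => (e x : ℕ), ?_⟩
  have map_e : univ.val.map (fun x => (e x : ℕ)) = M := by
    have map_coe := Multiset.map_univ_coe M
    rwa [← univ_map_equiv_to_embedding e, map_val, Multiset.map_map] at map_coe
  rw [content_one, map_e, Finsupp.toMultiset_toFinsupp]

theorem content_one_eq_iff {f g : α → ℕ} :
    content 1 g = content 1 f ↔ ∃ τ : Equiv.Perm α, f ∘ τ = g := by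
  classical
  constructor
  · intro h
    have fiber (c : ℕ) : Nonempty ({a // g a = c} ≃ {a // f a = c}) := by
      have count := congr_arg (Multiset.count c) (Multiset.toFinsupp.injective
        ((content_one g).symm.trans (h.trans (content_one f))))
      rw [← Fintype.card_eq, Fintype.card_subtype, Fintype.card_subtype]
      rw [Multiset.count_map, Multiset.count_map] at count
      simpa only [eq_comm (a := c)] using! count
    exact ⟨Equiv.ofFiberEquiv fun c => (fiber c).some, funext (Equiv.ofFiberEquiv_map _)⟩
  · rintro ⟨τ, rfl⟩
    exact Fintype.sum_equiv τ _ _ fun _ => rfl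

theorem sum_card_invariant_colorings [DecidableEq α] (f : α → ℕ) :
    ∑ σ : Equiv.Perm α, Nat.card {g : α → ℕ // content 1 g = content 1 f ∧ g ∘ σ = g} =
      (Fintype.card α).factorial := by
  classical
  let X := MulAction.orbit (Equiv.Perm α)ᵈᵐᵃ f
  have : Fintype (Equiv.Perm α)ᵈᵐᵃ := Fintype.ofEquiv _ DomMulAct.mk
  have : Fintype X := (Set.finite_range _).fintype
  have : Nonempty X := (MulAction.nonempty_orbit f).to_subtype
  have : Unique (MulAction.orbitRel.Quotient (Equiv.Perm α)ᵈᵐᵃ X) :=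
    ((MulAction.pretransitive_iff_unique_quotient_of_nonempty _ X).1 inferInstance).some
  -- Permutations act transitively on the colorings of a given content.
  have burnside := MulAction.sum_card_fixedBy_eq_card_orbits_mul_card_group (Equiv.Perm α)ᵈᵐᵃ X
  rw [Fintype.card_unique, one_mul] at burnside
  rw [← Fintype.card_perm, Fintype.card_congr (DomMulAct.mk (M := Equiv.Perm α)), ← burnside]
  refine Fintype.sum_equiv DomMulAct.mk _ _ fun σ => ?_
  rw [← Nat.card_eq_fintype_card]
  refine Nat.card_congr (Equiv.subtypeSubtypeEquivSubtypeInter _ _ |>.symm.trans ?_)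
  refine (Equiv.subtypeEquivRight fun g => ?_).subtypeEquiv fun g => ?_
  · rw [content_one_eq_iff]
    exact DomMulAct.mk.exists_congr fun _ => Iff.rfl
  · rw [MulAction.mem_fixedBy, Subtype.ext_iff]
    rfl

theorem sum_cyclePowerSum (α : Type*) [Fintype α] [DecidableEq α] :
    ∑ σ : Equiv.Perm α, cyclePowerSum σ =
      ((Fintype.card α).factorial : ℂ) • h (Fintype.card α) := by
  ext m
  simp only [map_sum, MvPowerSeries.coeff_smul, coeff_h, coeff_cyclePowerSum]
  split_ifs with hm
  · obtain ⟨f, rfl⟩ := exists_content_one_eq hm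
    rw [← Nat.cast_sum, sum_card_invariant_colorings, mul_one]
  · rw [mul_zero]
    refine Finset.sum_eq_zero fun σ _ => Nat.cast_eq_zero.2 (Nat.card_eq_zero.2 (Or.inl ⟨?_⟩))
    exact fun f => hm (f.2.1 ▸ degree_content_one f.1)

end Coloring

/-! ### Chains on injective words -/

section Chains

theorem cyclePowerSum_ofSubtype {α : Type*} [Fintype α] [DecidableEq α] (q : α → Prop)
    [DecidablePred q] (τ : Equiv.Perm (Subtype q)) :
    cyclePowerSum (Equiv.Perm.ofSubtype τ) =
      p 1 ^ (Fintype.card α - Fintype.card (Subtype q)) * cyclePowerSum τ := by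
  have card_support : #(Equiv.Perm.ofSubtype τ).support = #τ.support := by
    rw [← Equiv.Perm.sum_cycleType, ← Equiv.Perm.sum_cycleType, Equiv.Perm.cycleType_ofSubtype]
  have fixed_points : Fintype.card α - #τ.support =
      Fintype.card α - Fintype.card (Subtype q) + (Fintype.card (Subtype q) - #τ.support) :=
    (Nat.sub_add_sub_cancel (Fintype.card_subtype_le q) τ.support.card_le_univ).symm
  simp only [cyclePowerSum, Equiv.Perm.parts_partition, Equiv.Perm.cycleType_ofSubtype,
    card_support, Multiset.map_add, Multiset.prod_add, Multiset.map_replicate,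
    Multiset.prod_replicate]
  rw [fixed_points, pow_add, mul_left_comm]

theorem trans_toEmbedding_eq_self_iff {ι α : Type*} (w : ι ↪ α) (σ : Equiv.Perm α) :
    w.trans σ.toEmbedding = w ↔ ∀ a, ¬ a ∉ Set.range w → σ a = a := by
  simp [DFunLike.ext_iff]

theorem sum_cyclePowerSum_fixing {ι α : Type*} [Fintype ι] [Fintype α]
    [DecidableEq α] (w : ι ↪ α) :
    ∑ σ : Equiv.Perm α with w.trans σ.toEmbedding = w, cyclePowerSum σ =
      ((Fintype.card α - Fintype.card ι).factorial : ℂ) •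
        (p 1 ^ Fintype.card ι * h (Fintype.card α - Fintype.card ι)) := by
  classical
  have card_free : Fintype.card {a // a ∉ Set.range w} = Fintype.card α - Fintype.card ι := by
    rw [Fintype.card_subtype_compl]
    exact congr_arg _ (Set.card_range_of_injective w.injective)
  have sum_free : ∑ τ : Equiv.Perm {a // a ∉ Set.range w}, cyclePowerSum (Equiv.Perm.ofSubtype τ) =
      ∑ σ : Equiv.Perm α with w.trans σ.toEmbedding = w, cyclePowerSum σ := by
    rw [← sum_subtype_eq_sum_filter, subtype_univ]
    refine Fintype.sum_equiv ((Equiv.Perm.subtypeEquivSubtypePerm fun a => a ∉ Set.range w).trans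
      (Equiv.subtypeEquivRight fun σ => (trans_toEmbedding_eq_self_iff w σ).symm)) _ _ fun _ => rfl
  simp only [← sum_free, cyclePowerSum_ofSubtype, ← Finset.mul_sum, sum_cyclePowerSum, card_free,
    mul_smul_comm, Nat.sub_sub_self (Fintype.card_le_of_embedding w)]

theorem trace_wordRep (α : Type) [Fintype α] [DecidableEq α] (k : ℕ) (σ : Equiv.Perm α) :
    LinearMap.trace ℂ _ (wordRep α k σ) = (#{w : Fin k ↪ α | w.trans σ.toEmbedding = w} : ℂ) :=
  trace_eq_card_fixedPoints Finsupp.basisSingleOne _ _ fun w => by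
    rw [Finsupp.coe_basisSingleOne]
    exact Finsupp.mapDomain_single

theorem frobeniusChar_wordRep (α : Type) [Fintype α] [DecidableEq α] {k : ℕ}
    (hk : k ≤ Fintype.card α) :
    frobeniusChar (wordRep α k) = p 1 ^ k * h (Fintype.card α - k) := by
  have factorial_ne_zero : ((Fintype.card α).factorial : ℂ) ≠ 0 :=
    Nat.cast_ne_zero.2 (Nat.factorial_ne_zero _)
  rw [frobeniusChar, inv_smul_eq_iff₀ factorial_ne_zero]
  calc ∑ σ : Equiv.Perm α, LinearMap.trace ℂ _ (wordRep α k σ) • cyclePowerSum σ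
      = ∑ w : Fin k ↪ α, ∑ σ : Equiv.Perm α with w.trans σ.toEmbedding = w, cyclePowerSum σ := by
        simp only [trace_wordRep, Nat.cast_smul_eq_nsmul, ← sum_const, sum_filter]
        exact Finset.sum_comm
    _ = ((Fintype.card α).factorial : ℂ) • (p 1 ^ k * h (Fintype.card α - k)) := by
        simp only [sum_cyclePowerSum_fixing, sum_const, Finset.card_univ,
          Fintype.card_embedding_eq, Fintype.card_fin]
        rw [← Nat.cast_smul_eq_nsmul ℂ, smul_smul, ← Nat.cast_mul, mul_comm,
          Nat.factorial_mul_descFactorial hk]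

end Chains

/-! ### Acyclicity of the complex of injective words -/

section Words

variable {R : Type*} [CommRing R] {α : Type*}

/-- The operator `w ↦ a w` on combinations of words. -/
def prepend (a : α) : (List α →₀ R) →ₗ[R] (List α →₀ R) :=
  Finsupp.lmapDomain R R (List.cons a)

theorem prepend_single (a : α) (w : List α) (c : R) :
    prepend a (Finsupp.single w c) = Finsupp.single (a :: w) c :=
  Finsupp.mapDomain_single

theorem lhom_ext_prepend {N : Type*} [AddCommGroup N] [Module R N] {f g : (List α →₀ R) →ₗ[R] N}
    (nil : f (Finsupp.single [] 1) = g (Finsupp.single [] 1))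
    (cons : ∀ a x, f x = g x → f (prepend a x) = g (prepend a x)) : f = g := by
  ext w
  simp only [LinearMap.comp_apply, Finsupp.lsingle_apply]
  induction w with
  | nil => exact nil
  | cons a w ih => simpa only [prepend_single] using cons a _ ih

variable (R α) in
/-- The combinations of the injective words of length `r`. -/
def injWords (r : ℕ) : Submodule R (List α →₀ R) :=
  Finsupp.supported R R {w | w.Nodup ∧ w.length = r}

theorem injWords_le_iff {r : ℕ} {N : Submodule R (List α →₀ R)} :
    injWords R α r ≤ N ↔ ∀ w : List α, w.Nodup → w.length = r → Finsupp.single w 1 ∈ N := by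
  rw [injWords, Finsupp.supported_eq_span_single, Submodule.span_le, Set.image_subset_iff]
  exact ⟨fun hN w hw hr => hN ⟨hw, hr⟩, fun hN w hw => hN w hw.1 hw.2⟩

variable [DecidableEq α]

/-- The alternating sum of the words obtained from a word by deleting one occurrence of `b`, with
the sign `(-1)^i` for an occurrence at the position `i`. -/
def deleteWord (b : α) : List α → List α →₀ R
  | [] => 0
  | a :: w => (if a = b then Finsupp.single w 1 else 0) - prepend a (deleteWord b w)

/-- The linear extension of `deleteWord`. -/
def deleteLetter (b : α) : (List α →₀ R) →ₗ[R] (List α →₀ R) :=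
  Finsupp.linearCombination R (deleteWord b)

theorem deleteLetter_single_nil (b : α) (c : R) : deleteLetter b (Finsupp.single [] c) = 0 := by
  simp [deleteLetter, deleteWord]

theorem deleteLetter_prepend (a b : α) (x : List α →₀ R) :
    deleteLetter b (prepend a x) = (if a = b then x else 0) - prepend a (deleteLetter b x) := by
  induction x using Finsupp.induction_linear with
  | zero => simp
  | add x y hx hy =>
    rw [map_add, map_add, hx, hy, map_add, map_add]
    split_ifs <;> abel
  | single w c => simp [deleteLetter, deleteWord, prepend_single, smul_sub]

theorem deleteLetter_anticomm (a b : α) (x : List α →₀ R) :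
    deleteLetter b (deleteLetter a x) = -deleteLetter a (deleteLetter b x) := by
  have : deleteLetter b ∘ₗ deleteLetter a = -(deleteLetter (R := R) a ∘ₗ deleteLetter b) := by
    refine lhom_ext_prepend (by simp [deleteLetter_single_nil]) fun d x ih => ?_
    simp only [LinearMap.neg_apply, LinearMap.comp_apply] at ih ⊢
    simp only [deleteLetter_prepend, map_sub, apply_ite (deleteLetter _), map_zero, ih, map_neg]
    split_ifs <;> abel
  exact LinearMap.congr_fun this x

theorem deleteLetter_single_of_notMem {b : α} {w : List α} (hb : b ∉ w) :
    deleteLetter b (Finsupp.single w (1 : R)) = 0 := by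
  induction w with
  | nil => exact deleteLetter_single_nil b 1
  | cons a w ih =>
    rw [List.mem_cons, not_or] at hb
    rw [← prepend_single, deleteLetter_prepend, if_neg (Ne.symm hb.1), ih hb.2, map_zero, sub_zero]

theorem exists_deleteLetter_single_eq_smul (b : α) {w : List α} (hw : w.Nodup) :
    ∃ c : R, deleteLetter b (Finsupp.single w (1 : R)) = c • Finsupp.single (w.erase b) 1 := by
  induction w with
  | nil => exact ⟨0, by simp [deleteLetter_single_nil]⟩
  | cons a w ih =>
    rw [List.nodup_cons] at hw
    rw [← prepend_single, deleteLetter_prepend]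
    obtain rfl | hab := eq_or_ne a b
    · exact ⟨1, by simp [deleteLetter_single_of_notMem hw.1]⟩
    · obtain ⟨c, hc⟩ := ih hw.2
      refine ⟨-c, ?_⟩
      rw [if_neg hab, hc, map_smul, prepend_single, zero_sub, neg_smul,
        List.erase_cons_tail (by simpa using hab)]

theorem deleteLetter_mem_injWords (b : α) {r : ℕ} {x : List α →₀ R}
    (hx : x ∈ injWords R α (r + 1)) : deleteLetter b x ∈ injWords R α r := by
  suffices injWords R α (r + 1) ≤ (injWords R α r).comap (deleteLetter b) from this hx
  refine injWords_le_iff.2 fun w hw hr => ?_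
  rw [Submodule.mem_comap]
  by_cases hb : b ∈ w
  · obtain ⟨c, hc⟩ := exists_deleteLetter_single_eq_smul (R := R) b hw
    rw [hc]
    refine Submodule.smul_mem _ c (injWords_le_iff.1 le_rfl _ (hw.erase b) ?_)
    rw [List.length_erase_of_mem hb, hr, Nat.add_sub_cancel]
  · rw [deleteLetter_single_of_notMem hb]
    exact zero_mem _

theorem deleteLetter_eq_zero_of_mem_injWords_zero (b : α) {x : List α →₀ R}
    (hx : x ∈ injWords R α 0) : deleteLetter b x = 0 := by
  suffices injWords R α 0 ≤ LinearMap.ker (deleteLetter b) from this hx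
  refine injWords_le_iff.2 fun w _ hr => ?_
  rw [List.eq_nil_of_length_eq_zero hr, LinearMap.mem_ker, deleteLetter_single_nil]

variable [Fintype α]

/-- The signed operator that moves each letter of a word to the front. -/
def moveToFront : (List α →₀ R) →ₗ[R] (List α →₀ R) :=
  ∑ a, prepend a ∘ₗ deleteLetter a

theorem moveToFront_apply (x : List α →₀ R) :
    moveToFront x = ∑ a, prepend a (deleteLetter a x) := by
  simp [moveToFront]

theorem deleteLetter_moveToFront (b : α) (x : List α →₀ R) :
    deleteLetter b (moveToFront x) = deleteLetter b x + moveToFront (deleteLetter b x) := by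
  simp only [moveToFront_apply, map_sum, deleteLetter_prepend, deleteLetter_anticomm _ b, map_neg,
    sub_neg_eq_add, Finset.sum_add_distrib]
  simp

/-- The boundary map on combinations of all words; it restricts to `wordBoundary` on the injective
ones. -/
def listBoundary : (List α →₀ R) →ₗ[R] (List α →₀ R) :=
  ∑ a, deleteLetter a

theorem listBoundary_apply (x : List α →₀ R) : listBoundary x = ∑ a, deleteLetter a x := by
  simp [listBoundary]

theorem listBoundary_single_nil (c : R) :
    listBoundary (Finsupp.single ([] : List α) c) = 0 := by
  simp [listBoundary_apply, deleteLetter_single_nil]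

theorem listBoundary_prepend (a : α) (x : List α →₀ R) :
    listBoundary (prepend a x) = x - prepend a (listBoundary x) := by
  simp [listBoundary_apply, deleteLetter_prepend]

theorem listBoundary_listBoundary (x : List α →₀ R) : listBoundary (listBoundary x) = 0 := by
  have : listBoundary ∘ₗ listBoundary = (0 : (List α →₀ R) →ₗ[R] (List α →₀ R)) := by
    refine lhom_ext_prepend (by simp [listBoundary_single_nil]) fun a x ih => ?_
    simp only [LinearMap.comp_apply, LinearMap.zero_apply] at ih ⊢
    simp [listBoundary_prepend, ih]
  exact LinearMap.congr_fun this x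

/-- The sum of the words obtained by prepending a letter that does not occur. -/
def prependNew : (List α →₀ R) →ₗ[R] (List α →₀ R) :=
  Finsupp.linearCombination R fun w => ∑ a ∈ w.toFinsetᶜ, Finsupp.single (a :: w) 1

theorem prependNew_single (w : List α) :
    prependNew (Finsupp.single w (1 : R)) =
      ∑ a ∈ w.toFinsetᶜ, prepend a (Finsupp.single w 1) := by
  simp [prependNew, prepend_single]

theorem prependNew_deleteLetter_single (b : α) {w : List α} (hw : w.Nodup) :
    prependNew (deleteLetter b (Finsupp.single w (1 : R))) =
      ∑ a ∈ w.toFinsetᶜ, prepend a (deleteLetter b (Finsupp.single w 1)) +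
        prepend b (deleteLetter b (Finsupp.single w 1)) := by
  by_cases hb : b ∈ w
  · obtain ⟨c, hc⟩ := exists_deleteLetter_single_eq_smul (R := R) b hw
    have new_letters : (w.erase b).toFinsetᶜ = insert b w.toFinsetᶜ := by
      ext a
      simp [hw.mem_erase_iff, or_iff_not_imp_left]
    have hb' : b ∉ w.toFinsetᶜ := by simpa using hb
    simp only [hc, map_smul, prependNew_single, new_letters, sum_insert hb', ← smul_sum, smul_add]
    exact add_comm _ _
  · simp [deleteLetter_single_of_notMem hb]

theorem listBoundary_prependNew_single_add {w : List α} (hw : w.Nodup) :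
    listBoundary (prependNew (Finsupp.single w (1 : R))) +
        prependNew (listBoundary (Finsupp.single w 1)) =
      (Fintype.card α - w.length) • Finsupp.single w 1 + moveToFront (Finsupp.single w 1) := by
  rw [prependNew_single, map_sum, listBoundary_apply, map_sum]
  simp only [listBoundary_prepend, prependNew_deleteLetter_single _ hw]
  rw [sum_sub_distrib, sum_const, card_compl, List.toFinset_card_of_nodup hw,
    Finset.sum_add_distrib, moveToFront_apply, Finset.sum_comm]
  simp only [listBoundary_apply, map_sum]
  abel

theorem prependNew_mem_injWords {r : ℕ} {x : List α →₀ R} (hx : x ∈ injWords R α r) :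
    prependNew x ∈ injWords R α (r + 1) := by
  suffices injWords R α r ≤ (injWords R α (r + 1)).comap prependNew from this hx
  refine injWords_le_iff.2 fun w hw hr => ?_
  rw [Submodule.mem_comap, prependNew_single]
  refine sum_mem fun a ha => ?_
  rw [prepend_single]
  exact injWords_le_iff.1 le_rfl _ (List.nodup_cons.2 ⟨by simpa using ha, hw⟩) (by simp [hr])

theorem listBoundary_prependNew_add {r : ℕ} {x : List α →₀ R} (hx : x ∈ injWords R α r) :
    listBoundary (prependNew x) + prependNew (listBoundary x) =
      (Fintype.card α - r) • x + moveToFront x := by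
  suffices injWords R α r ≤ LinearMap.eqLocus
      (listBoundary ∘ₗ prependNew + prependNew ∘ₗ listBoundary)
      ((Fintype.card α - r) • LinearMap.id + moveToFront) from this hx
  exact injWords_le_iff.2 fun w hw hr => hr ▸ listBoundary_prependNew_single_add hw

theorem eq_zero_of_moveToFront_eq [IsDomain R] [CharZero R] {r c : ℕ} (hc : c ≠ 0)
    {x : List α →₀ R} (hx : x ∈ injWords R α r) (eigen : moveToFront x = -(c • x)) : x = 0 := by
  have eq_zero {c : ℕ} {x : List α →₀ R} (hc : c ≠ 0) (eigen : moveToFront x = -(c • x))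
      (deletions : ∀ b, deleteLetter b x = 0) : x = 0 := by
    simp only [moveToFront_apply, deletions, map_zero, sum_const_zero] at eigen
    exact (smul_eq_zero.1 (neg_eq_zero.1 eigen.symm)).resolve_left hc
  induction r generalizing c x with
  | zero => exact eq_zero hc eigen fun b => deleteLetter_eq_zero_of_mem_injWords_zero b hx
  | succ r ih =>
    refine eq_zero hc eigen fun b => ih c.succ_ne_zero (deleteLetter_mem_injWords b hx) ?_
    have commutation := deleteLetter_moveToFront b x
    rw [eigen, map_neg, map_nsmul] at commutation
    rw [Nat.succ_eq_add_one, succ_nsmul, neg_add, commutation]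
    abel

end Words

theorem exists_listBoundary_eq {K α : Type*} [Field K] [CharZero K] [DecidableEq α] [Fintype α]
    {r : ℕ} (hr : r < Fintype.card α) {z : List α →₀ K} (hz : z ∈ injWords K α r)
    (cycle : listBoundary z = 0) : ∃ y ∈ injWords K α (r + 1), listBoundary y = z := by
  have : Finite {w : List α | w.Nodup ∧ w.length = r} :=
    ((List.finite_length_eq α r).subset fun w hw => hw.2).to_subtype
  have : FiniteDimensional K (injWords K α r) :=
    Module.Finite.equiv (Finsupp.supportedEquivFinsupp _).symm
  let cycles : Submodule K (List α →₀ K) := injWords K α r ⊓ LinearMap.ker listBoundary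
  have : FiniteDimensional K cycles := Submodule.finiteDimensional_inf_left _ _
  let f : (List α →₀ K) →ₗ[K] (List α →₀ K) := listBoundary ∘ₗ prependNew
  have maps_cycles (x) (hx : x ∈ cycles) : f x ∈ cycles := by
    have mem := prependNew_mem_injWords hx.1
    refine ⟨?_, listBoundary_listBoundary _⟩
    rw [LinearMap.comp_apply, listBoundary_apply]
    exact sum_mem fun b _ => deleteLetter_mem_injWords b mem
  -- On cycles the homotopy is `card α - r + moveToFront`, and the eigenvalues of `moveToFront`
  -- are never negative integers.
  have injOn : Set.InjOn f cycles := by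
    refine LinearMap.disjoint_ker_iff_injOn.1 (LinearMap.disjoint_ker.2 fun x hx hfx => ?_)
    have homotopy := listBoundary_prependNew_add hx.1
    rw [show listBoundary (prependNew x) = 0 from hfx, LinearMap.mem_ker.1 hx.2, map_zero,
      add_zero] at homotopy
    exact eq_zero_of_moveToFront_eq (Nat.sub_ne_zero_of_lt hr) hx.1
      (eq_neg_of_add_eq_zero_right homotopy.symm)
  obtain ⟨y, hy, hyz⟩ := (LinearMap.injOn_iff_surjOn maps_cycles).1 injOn ⟨hz, cycle⟩
  exact ⟨prependNew y, prependNew_mem_injWords hy.1, hyz⟩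

section Exactness

/-- The chains on injective words, viewed as combinations of lists. -/
def wordsToLists (α : Type) (r : ℕ) : ((Fin r ↪ α) →₀ ℂ) →ₗ[ℂ] (List α →₀ ℂ) :=
  Finsupp.lmapDomain ℂ ℂ fun w => List.ofFn w

theorem wordsToLists_single {α : Type} {r : ℕ} (w : Fin r ↪ α) (c : ℂ) :
    wordsToLists α r (Finsupp.single w c) = Finsupp.single (List.ofFn w) c :=
  Finsupp.mapDomain_single

theorem wordsToLists_injective (α : Type) (r : ℕ) : Function.Injective (wordsToLists α r) :=
  Finsupp.mapDomain_injective fun _ _ h => DFunLike.coe_injective (List.ofFn_injective h)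

theorem range_wordsToLists (α : Type) (r : ℕ) :
    LinearMap.range (wordsToLists α r) = injWords ℂ α r := by
  have words : Set.range (fun w : Fin r ↪ α => List.ofFn w) = {w | w.Nodup ∧ w.length = r} := by
    refine Set.Subset.antisymm ?_ ?_
    · rintro _ ⟨w, rfl⟩
      exact ⟨List.nodup_ofFn.2 w.injective, List.length_ofFn⟩
    · rintro w ⟨hw, rfl⟩
      exact ⟨⟨w.get, List.nodup_iff_injective_get.1 hw⟩, List.ofFn_get w⟩
  rw [injWords, ← words, ← Set.image_univ, ← Finsupp.lmapDomain_supported, Finsupp.supported_univ,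
    Submodule.map_top, wordsToLists]

theorem listBoundary_single_ofFn {R α : Type*} [CommRing R] [Fintype α] [DecidableEq α] {r : ℕ}
    (w : Fin (r + 1) → α) : listBoundary (Finsupp.single (List.ofFn w) (1 : R)) =
      ∑ i : Fin (r + 1), (-1 : R) ^ (i : ℕ) • Finsupp.single (List.ofFn (w ∘ i.succAbove)) 1 := by
  induction r with
  | zero =>
    rw [List.ofFn_succ, ← prepend_single, listBoundary_prepend]
    simp [listBoundary_single_nil]
  | succ r ih =>
    rw [Fin.sum_univ_succ, List.ofFn_succ, ← prepend_single, listBoundary_prepend, ih,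
      sub_eq_add_neg, map_sum, ← sum_neg_distrib]
    congr 1
    · simp [Function.comp_def]
    · refine Finset.sum_congr rfl fun i _ => ?_
      rw [map_smul, prepend_single, ← neg_smul, Fin.val_succ, pow_succ, mul_neg_one, List.ofFn_succ]
      simp [Function.comp_def]

variable {α : Type}

theorem wordsToLists_wordBoundary [Fintype α] [DecidableEq α] {r : ℕ}
    (x : (Fin (r + 1) ↪ α) →₀ ℂ) :
    wordsToLists α r (wordBoundary α r x) = listBoundary (wordsToLists α (r + 1) x) := by
  suffices wordsToLists α r ∘ₗ wordBoundary α r = listBoundary ∘ₗ wordsToLists α (r + 1) from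
    LinearMap.congr_fun this x
  ext1 w
  ext1
  simp only [LinearMap.comp_apply, Finsupp.lsingle_apply, wordsToLists_single,
    listBoundary_single_ofFn, wordBoundary, Finsupp.linearCombination_single, one_smul, map_sum,
    map_smul]
  rfl

theorem wordBoundary_wordBoundary [Finite α] {r : ℕ} (x : (Fin (r + 2) ↪ α) →₀ ℂ) :
    wordBoundary α r (wordBoundary α (r + 1) x) = 0 := by
  classical
  have := Fintype.ofFinite α
  apply wordsToLists_injective α r
  rw [wordsToLists_wordBoundary, wordsToLists_wordBoundary, listBoundary_listBoundary, map_zero]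

theorem exists_wordBoundary_eq_of_listBoundary [Fintype α] [DecidableEq α] {r : ℕ}
    (hr : r < Fintype.card α) {x : (Fin r ↪ α) →₀ ℂ}
    (cycle : listBoundary (wordsToLists α r x) = 0) :
    ∃ y, wordBoundary α r y = x := by
  have mem : wordsToLists α r x ∈ injWords ℂ α r :=
    range_wordsToLists α r ▸ LinearMap.mem_range_self _ _
  obtain ⟨y, hy, hyx⟩ := exists_listBoundary_eq hr mem cycle
  rw [← range_wordsToLists] at hy
  obtain ⟨y', rfl⟩ := hy
  exact ⟨y', wordsToLists_injective α r ((wordsToLists_wordBoundary y').trans hyx)⟩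

theorem exact_wordBoundary [Fintype α] {r : ℕ} (hr : r + 1 < Fintype.card α) :
    Function.Exact (wordBoundary α (r + 1)) (wordBoundary α r) := by
  classical
  refine fun x => ⟨fun hx => exists_wordBoundary_eq_of_listBoundary hr ?_, ?_⟩
  · rw [← wordsToLists_wordBoundary, hx, map_zero]
  · rintro ⟨y, rfl⟩
    exact wordBoundary_wordBoundary y

theorem wordBoundary_zero_surjective [Finite α] [Nonempty α] :
    Function.Surjective (wordBoundary α 0) := by
  classical
  have := Fintype.ofFinite α
  refine fun x => exists_wordBoundary_eq_of_listBoundary Fintype.card_pos ?_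
  have mem : wordsToLists α 0 x ∈ injWords ℂ α 0 :=
    range_wordsToLists α 0 ▸ LinearMap.mem_range_self _ _
  simp [listBoundary_apply, deleteLetter_eq_zero_of_mem_injWords_zero _ mem]

end Exactness

section Homology

theorem trace_eq_add_of_exact {k U V W : Type*} [Field k] [AddCommGroup U] [Module k U]
    [AddCommGroup V] [Module k V] [AddCommGroup W] [Module k W] [FiniteDimensional k V]
    {i : U →ₗ[k] V} {f : V →ₗ[k] W} (exact : Function.Exact i f) (hi : Function.Injective i)
    (hf : Function.Surjective f) {A : Module.End k U} {B : Module.End k V} {C : Module.End k W}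
    (hAB : ∀ u, i (A u) = B (i u)) (hBC : ∀ v, f (B v) = C (f v)) :
    LinearMap.trace k V B = LinearMap.trace k U A + LinearMap.trace k W C := by
  have := Module.Finite.of_injective i hi
  have := Module.Finite.of_surjective f hf
  obtain ⟨s, hs⟩ := f.exists_rightInverse_of_surjective (LinearMap.range_eq_top.2 hf)
  obtain ⟨q, hq⟩ := i.exists_leftInverse_of_injective (LinearMap.ker_eq_bot.2 hi)
  replace hs (w) : f (s w) = w := LinearMap.congr_fun hs w
  replace hq (u) : q (i u) = u := LinearMap.congr_fun hq u
  let π : V →ₗ[k] U := q ∘ₗ (LinearMap.id - s ∘ₗ f)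
  have splitting : i ∘ₗ π + s ∘ₗ f = LinearMap.id := by
    ext v
    obtain ⟨u, hu⟩ := (exact (v - s (f v))).1 (by rw [map_sub, hs, sub_self])
    have i_π : i (π v) = v - s (f v) := by
      rw [← hu, ← hq u, hu]
      rfl
    simp [i_π]
  have on_kernel : π ∘ₗ B ∘ₗ i = A := by
    ext u
    simp [π, ← hAB, exact.apply_apply_eq_zero, hq]
  have on_cokernel : f ∘ₗ B ∘ₗ s = C := by
    ext w
    simp [hBC, hs]
  calc LinearMap.trace k V B
      = LinearMap.trace k V (B ∘ₗ (i ∘ₗ π + s ∘ₗ f)) := by rw [splitting, LinearMap.comp_id]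
    _ = LinearMap.trace k V ((B ∘ₗ i) ∘ₗ π) + LinearMap.trace k V ((B ∘ₗ s) ∘ₗ f) := by
        rw [LinearMap.comp_add, map_add, LinearMap.comp_assoc, LinearMap.comp_assoc]
    _ = LinearMap.trace k U A + LinearMap.trace k W C := by
        rw [LinearMap.trace_comp_comm', LinearMap.trace_comp_comm' _ (B ∘ₗ s), on_kernel,
          on_cokernel]

variable {α : Type} [Fintype α] [DecidableEq α]

theorem frobeniusChar_eq_add_of_exact {U V W : Type} [AddCommGroup U] [Module ℂ U]
    [AddCommGroup V] [Module ℂ V] [AddCommGroup W] [Module ℂ W] [FiniteDimensional ℂ V]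
    {ρ : Representation ℂ (Equiv.Perm α) U} {σ : Representation ℂ (Equiv.Perm α) V}
    {τ : Representation ℂ (Equiv.Perm α) W} {i : U →ₗ[ℂ] V} {f : V →ₗ[ℂ] W}
    (exact : Function.Exact i f) (hi : Function.Injective i) (hf : Function.Surjective f)
    (hρσ : ∀ g u, i (ρ g u) = σ g (i u)) (hστ : ∀ g v, f (σ g v) = τ g (f v)) :
    frobeniusChar σ = frobeniusChar ρ + frobeniusChar τ := by
  simp only [frobeniusChar, ← smul_add, ← sum_add_distrib, ← add_smul,
    fun g => trace_eq_add_of_exact exact hi hf (hρσ g) (hστ g)]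

theorem frobeniusChar_congr {V W : Type} [AddCommGroup V] [Module ℂ V] [AddCommGroup W]
    [Module ℂ W] {ρ : Representation ℂ (Equiv.Perm α) V} {σ : Representation ℂ (Equiv.Perm α) W}
    (φ : ρ.Equiv σ) : frobeniusChar ρ = frobeniusChar σ := by
  have traces (g : Equiv.Perm α) : LinearMap.trace ℂ V (ρ g) = LinearMap.trace ℂ W (σ g) :=
    congrFun (Representation.char_iso φ) g
  simp only [frobeniusChar, traces]

/-- The representation of the symmetric group of `α` on the cycles `ker ∂_r` of the complex of
injective words. -/
def cycleRep (α : Type) (r : ℕ) :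
    Representation ℂ (Equiv.Perm α) (LinearMap.ker (wordBoundary α r)) :=
  (wordRep α (r + 1)).subrepresentation _ fun σ x hx => by
    rw [LinearMap.mem_ker] at hx
    rw [Submodule.mem_comap, LinearMap.mem_ker, wordBoundary_comm, hx, map_zero]

/-- The Frobenius characteristic of the cycles `ker ∂_r` of the complex of injective words. -/
def cycleChar (α : Type) [Fintype α] [DecidableEq α] (r : ℕ) : Series :=
  frobeniusChar (V := LinearMap.ker (wordBoundary α r)) (cycleRep α r)

theorem frobeniusChar_wordRep_one [Nonempty α] :
    frobeniusChar (wordRep α 1) = cycleChar α 0 + frobeniusChar (wordRep α 0) :=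
  frobeniusChar_eq_add_of_exact (wordBoundary α 0).exact_subtype_ker_map
    (Submodule.subtype_injective _) wordBoundary_zero_surjective (fun _ _ => rfl)
    (wordBoundary_comm α 0)

theorem frobeniusChar_wordRep_add_two {r : ℕ} (hr : r + 1 < Fintype.card α) :
    frobeniusChar (wordRep α (r + 2)) =
      cycleChar α (r + 1) + cycleChar α r := by
  let toCycles := (wordBoundary α (r + 1)).codRestrict _
    fun x => LinearMap.mem_ker.2 (wordBoundary_wordBoundary x)
  refine frobeniusChar_eq_add_of_exact (f := toCycles) (fun x => ?_)
    (Submodule.subtype_injective (LinearMap.ker (wordBoundary α (r + 1)))) ?_ (fun _ _ => rfl)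
    fun σ x => Subtype.ext (wordBoundary_comm α (r + 1) σ x)
  · rw [← (wordBoundary α (r + 1)).exact_subtype_ker_map x]
    exact Subtype.ext_iff
  · rintro ⟨z, hz⟩
    obtain ⟨y, hy⟩ := (exact_wordBoundary hr z).1 hz
    exact ⟨y, Subtype.ext hy⟩

theorem cycleChar_eq_sum {r : ℕ} (hr : r < Fintype.card α) :
    cycleChar α r = ∑ k ∈ range (r + 2), (-1) ^ k * frobeniusChar (wordRep α (r + 1 - k)) := by
  induction r with
  | zero =>
    have : Nonempty α := Fintype.card_pos_iff.1 hr
    simp [eq_sub_of_add_eq frobeniusChar_wordRep_one.symm, sum_range_succ, sub_eq_add_neg]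
  | succ r ih =>
    rw [eq_sub_of_add_eq (frobeniusChar_wordRep_add_two hr).symm, ih (by omega),
      sum_range_succ' _ (r + 2)]
    simp only [pow_succ, mul_neg_one, neg_mul, sum_neg_distrib, pow_zero, one_mul, sub_eq_neg_add]
    refine congrArg (-· + _) (Finset.sum_congr rfl fun k _ => ?_)
    rw [Nat.add_sub_add_right]

theorem frobeniusChar_injectiveWordsHomology_eq_cycleChar {r : ℕ} (hr : Fintype.card α = r + 1) :
    frobeniusChar (injectiveWordsHomology α r) = cycleChar α r := by
  have no_words : IsEmpty (Fin (r + 2) ↪ α) :=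
    Function.Embedding.isEmpty_of_card_lt (by simp [hr])
  have no_boundaries : (LinearMap.range (wordBoundary α (r + 1))).submoduleOf
      (LinearMap.ker (wordBoundary α r)) = ⊥ := by
    rw [Subsingleton.elim (wordBoundary α (r + 1)) 0, LinearMap.range_zero, Submodule.submoduleOf,
      Submodule.comap_bot, Submodule.ker_subtype]
  symm
  exact frobeniusChar_congr (.mk (Submodule.quotEquivOfEqBot _ no_boundaries).symm fun _ => rfl)

theorem frobeniusChar_injectiveWordsHomology {r : ℕ} (hr : Fintype.card α = r + 1) :
    frobeniusChar (injectiveWordsHomology α r) = delta (r + 1) := by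
  rw [frobeniusChar_injectiveWordsHomology_eq_cycleChar hr, cycleChar_eq_sum (by omega),
    delta_eq_sum]
  refine Finset.sum_congr rfl fun k hk => ?_
  rw [frobeniusChar_wordRep α (by omega), hr, Nat.sub_sub_self (mem_range_succ_iff.1 hk), mul_assoc]

end Homology

/-! ### Degree four -/

section DegreeFour

open MvPowerSeries (expand)

theorem IsExp.one {R : Type*} [CommRing R] {q g : ℕ → R} (hg : IsExp q g) : g 1 = q 0 := by
  simpa [hg.zero] using hg.succ 0

theorem IsExp.two_nsmul_two {R : Type*} [CommRing R] {q g : ℕ → R} (hg : IsExp q g) :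
    2 • g 2 = q 0 ^ 2 + q 1 := by
  simpa [Nat.antidiagonal_succ, hg.zero, hg.one, sq] using hg.succ 1

theorem plethysm_h_one (f : Series) : plethysm (h 1) f = f :=
  (isExp_plethysm_h f).one.trans (MvPowerSeries.expand_one_apply f)

theorem plethysm_e_one (f : Series) : plethysm (e 1) f = f := by
  simpa using (isExp_plethysm_e f).one

theorem plethysm_h_two (f : Series) :
    plethysm (h 2) f = (2 : ℂ)⁻¹ • (f ^ 2 + expand 2 two_ne_zero f) := by
  rw [eq_inv_smul_iff₀ two_ne_zero]
  simpa [two_smul] using (isExp_plethysm_h f).two_nsmul_two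

theorem plethysm_e_two (f : Series) :
    plethysm (e 2) f = (2 : ℂ)⁻¹ • (f ^ 2 - expand 2 two_ne_zero f) := by
  rw [eq_inv_smul_iff₀ two_ne_zero]
  simpa [two_smul, sub_eq_add_neg] using (isExp_plethysm_e f).two_nsmul_two

theorem ramanujanSum_two (r : ℕ) : ramanujanSum r 2 = if 2 ∣ r then 1 else -1 := by
  have total := sum_ramanujanSum r two_ne_zero
  rw [Nat.prime_two.sum_divisors, ramanujanSum_one_right] at total
  rw [eq_sub_of_add_eq total]
  split_ifs <;> norm_num

theorem divisors_four : Nat.divisors 4 = {1, 2, 4} := by decide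

theorem ramanujanSum_four (r : ℕ) :
    ramanujanSum r 4 = if 4 ∣ r then 2 else if 2 ∣ r then -2 else 0 := by
  have total := sum_ramanujanSum r four_ne_zero
  rw [divisors_four, sum_insert (by decide), sum_insert (by decide), sum_singleton,
    ramanujanSum_one_right, ramanujanSum_two, ← add_assoc] at total
  have two_dvd : 4 ∣ r → 2 ∣ r := dvd_trans (by decide)
  rw [eq_sub_of_add_eq' total]
  split_ifs <;> first | (exfalso; tauto) | norm_num

theorem cyclicIndChar_two (r : ℕ) :
    cyclicIndChar 2 r = (2 : ℂ)⁻¹ • (p 1 ^ 2 + ramanujanSum r 2 • p 2) := by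
  have expansion := nsmul_cyclicIndChar 2 r
  rw [Nat.prime_two.sum_divisors, ramanujanSum_one_right, ← Nat.cast_smul_eq_nsmul ℂ] at expansion
  rw [eq_inv_smul_iff₀ two_ne_zero]
  simpa [add_comm] using expansion

theorem cyclicIndChar_four (r : ℕ) : cyclicIndChar 4 r =
    (4 : ℂ)⁻¹ • (p 1 ^ 4 + ramanujanSum r 2 • p 2 ^ 2 + ramanujanSum r 4 • p 4) := by
  have expansion := nsmul_cyclicIndChar 4 r
  rw [divisors_four, sum_insert (by decide), sum_insert (by decide), sum_singleton,
    ramanujanSum_one_right, ← Nat.cast_smul_eq_nsmul ℂ] at expansion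
  rw [eq_inv_smul_iff₀ (by norm_num)]
  simpa [add_assoc] using expansion

/-- The symmetric function `a p_1^4 + b p_1^2 p_2 + c p_2^2 + d p_4`; the degree four pieces of
both decompositions are of this form. -/
def quartic (a b c d : ℂ) : Series :=
  a • p 1 ^ 4 + b • (p 1 ^ 2 * p 2) + c • p 2 ^ 2 + d • p 4

open MvPolynomial in
theorem aeval_eq_quartic (a b c d : ℂ) : aeval (fun k : ℕ => p (k + 1))
    (a • X 0 ^ 4 + b • (X 0 ^ 2 * X 1) + c • X 1 ^ 2 + d • X 3 : MvPolynomial ℕ ℂ) =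
      quartic a b c d := by
  simp [quartic]

theorem omega_quartic (a b c d : ℂ) : omega (quartic a b c d) = quartic a (-b) c (-d) := by
  rw [← aeval_eq_quartic, omega_aeval]
  simp [quartic, Odd.neg_one_pow (n := 3) (by decide)]

theorem quartic_right_inj {a b c d a' b' c' d' : ℂ} (h : quartic a b c d = quartic a' b' c' d') :
    d = d' := by
  rw [← aeval_eq_quartic, ← aeval_eq_quartic] at h
  simpa using congrArg (MvPolynomial.eval (Pi.single 3 1)) (algebraicIndependent_p h)

theorem lie_two : lie 2 = (2 : ℂ)⁻¹ • (p 1 ^ 2 - p 2) := by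
  simp [lie, cyclicIndChar_two, ramanujanSum_two, sub_eq_add_neg]

theorem lieTwo_two : lieTwo 2 = (2 : ℂ)⁻¹ • (p 1 ^ 2 + p 2) := by
  simp [lieTwo, cyclicIndChar_two, ramanujanSum_two]

theorem lie_four : lie 4 = (4 : ℂ)⁻¹ • (p 1 ^ 4 - p 2 ^ 2) := by
  simp [lie, cyclicIndChar_four, ramanujanSum_two, ramanujanSum_four, sub_eq_add_neg]

theorem lieTwo_four : lieTwo 4 = (4 : ℂ)⁻¹ • (p 1 ^ 4 + p 2 ^ 2 + (2 : ℂ) • p 4) := by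
  have two_part : padicValNat 2 4 = 2 := padicValNat.prime_pow 2
  simp [lieTwo, cyclicIndChar_four, ramanujanSum_two, ramanujanSum_four, two_part]

section

variable {q : ℕ → Series}

theorem deg_four_sumGeTwo (hq : ∀ n, (q n).IsHomogeneous n) : deg 4 (sumGeTwo q) = q 4 := by
  rw [deg, homogeneousComponent_sumGeTwo hq, if_pos (by decide)]

theorem deg_four_sumGeTwo_sq (hq : ∀ n, (q n).IsHomogeneous n) :
    deg 4 (sumGeTwo q ^ 2) = q 2 ^ 2 := by
  rw [deg, sq, homogeneousComponent_mul, Nat.sum_antidiagonal_eq_sum_range_succ_mk]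
  simp [sum_range_succ, homogeneousComponent_sumGeTwo hq, sq]

theorem deg_four_expand_two_sumGeTwo (hq : ∀ n, (q n).IsHomogeneous n) :
    deg 4 (expand 2 two_ne_zero (sumGeTwo q)) = expand 2 two_ne_zero (q 2) := by
  rw [deg, homogeneousComponent_expand, if_pos (by decide), homogeneousComponent_sumGeTwo hq,
    if_pos le_rfl]

theorem deg_four_plethysm_h_two (hq : ∀ n, (q n).IsHomogeneous n) :
    deg 4 (plethysm (h 2) (sumGeTwo q)) =
      (2 : ℂ)⁻¹ • (q 2 ^ 2 + expand 2 two_ne_zero (q 2)) := by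
  rw [plethysm_h_two, ← deg_four_sumGeTwo_sq hq, ← deg_four_expand_two_sumGeTwo hq]
  simp only [deg, map_smul, map_add]

theorem deg_four_plethysm_e_two (hq : ∀ n, (q n).IsHomogeneous n) :
    deg 4 (plethysm (e 2) (sumGeTwo q)) =
      (2 : ℂ)⁻¹ • (q 2 ^ 2 - expand 2 two_ne_zero (q 2)) := by
  rw [plethysm_e_two, ← deg_four_sumGeTwo_sq hq, ← deg_four_expand_two_sumGeTwo hq]
  simp only [deg, map_smul, map_sub]

end

theorem deltaPiece_four_one : deltaPiece 4 1 = quartic 4⁻¹ 0 4⁻¹ 2⁻¹ := by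
  rw [deltaPiece, plethysm_e_one, deg_four_sumGeTwo isHomogeneous_lieTwo, lieTwo_four, quartic]
  algebra

theorem deltaPiece_four_two : deltaPiece 4 2 = quartic 8⁻¹ 4⁻¹ (-8⁻¹) (-4⁻¹) := by
  rw [deltaPiece, deg_four_plethysm_e_two isHomogeneous_lieTwo, lieTwo_two, quartic]
  simp only [map_smul, map_add, map_pow, expand_p, mul_one, Nat.reduceMul]
  algebra

theorem hodgePiece_four_one : hodgePiece 4 1 = quartic 4⁻¹ 0 (-4⁻¹) 0 := by
  rw [hodgePiece, plethysm_h_one, deg_four_sumGeTwo isHomogeneous_lie, lie_four, quartic]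
  algebra

theorem hodgePiece_four_two : hodgePiece 4 2 = quartic 8⁻¹ (-4⁻¹) (3 / 8) (-4⁻¹) := by
  rw [hodgePiece, deg_four_plethysm_h_two isHomogeneous_lie, lie_two, quartic]
  simp only [map_smul, map_sub, map_pow, expand_p, mul_one, Nat.reduceMul]
  algebra

theorem deltaPiece_four_ne_omega_hodgePiece {k j : ℕ} (hk : k = 1 ∨ k = 2) (hj : j = 1 ∨ j = 2) :
    deltaPiece 4 k ≠ omega (hodgePiece 4 j) := by
  intro eq
  rcases hk with rfl | rfl <;> rcases hj with rfl | rfl <;>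
    simp only [deltaPiece_four_one, deltaPiece_four_two, hodgePiece_four_one, hodgePiece_four_two,
      omega_quartic] at eq <;>
    have := quartic_right_inj eq <;> norm_num at this

end DegreeFour

end SymFn

end

open SymFn in
theorem mainTheorem5 :
    (∀ n : ℕ, 2 ≤ n →
      delta n = ∑ k ∈ Finset.range (n + 1), (-1) ^ k * p 1 ^ (n - k) * h k ∧
      delta n = p 1 * delta (n - 1) + (-1) ^ n * h n ∧
      frobeniusChar (injectiveWordsHomology (Fin n) (n - 1)) = delta n) ∧
    (∀ n : ℕ, 1 ≤ n →
      ∑ᶠ (r : ℕ) (_ : 1 ≤ r), omega (hodgePiece n r) =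
        ∑ k ∈ Finset.range (n + 1), (-1) ^ k * p 1 ^ (n - k) * h k ∧
      ∑ᶠ (r : ℕ) (_ : 1 ≤ r), deltaPiece n r =
        ∑ k ∈ Finset.range (n + 1), (-1) ^ k * p 1 ^ (n - k) * h k) ∧
    (∀ n : ℕ, 2 ≤ n →
      ∑ᶠ (r : ℕ) (_ : 1 ≤ r),
          (-1) ^ (r - 1) * omega (deg n (plethysm (e r) (sumGeTwo lie))) =
        schur (hookTwo n) ∧
      ∑ᶠ (r : ℕ) (_ : 1 ≤ r), (-1) ^ (r - 1) * deg n (plethysm (h r) (sumGeTwo lieTwo)) =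
        schur (hookTwo n)) ∧
    (∀ k ∈ ({1, 2} : Set ℕ), ∀ j ∈ ({1, 2} : Set ℕ), deltaPiece 4 k ≠ omega (hodgePiece 4 j)) := by
  refine ⟨fun n hn => ?_, fun n hn => ?_, fun n hn => ?_, fun k hk j hj => ?_⟩
  · obtain ⟨n, rfl⟩ := Nat.exists_eq_add_of_le' hn
    exact ⟨delta_eq_sum _, delta_succ _,
      frobeniusChar_injectiveWordsHomology (Fintype.card_fin _)⟩
  · exact ⟨finsum_omega_hodgePiece (by omega), finsum_deltaPiece (by omega)⟩
  · obtain ⟨n, rfl⟩ := Nat.exists_eq_add_of_le' hn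
    rw [schur_hookTwo]
    exact ⟨finsum_signed_omega_deg_plethysm_e_lie (n + 1),
      finsum_signed_deg_plethysm_h_lieTwo (n + 1)⟩
  · exact deltaPiece_four_ne_omega_hodgePiece hk hj
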